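/- Let $n\ge 1$, $1<p<\infty$, $\gamma>1$ and $s_1\le s_2$ be real. Let $g:[0,\infty)\to\mathbb R$ be nondecreasing, bounded below by $1$, and of class $C^{n+1}$ on $(0,\infty)$, with $$\sup_{0<t<1}\int_0^\infty\Big|\partial_r^{\,n+1}\Big(r^{n-1}e^{-r^\gamma/g(rt^{-1/\gamma})}\Big)\Big|\,dr<\infty .$$ For $t>0$ let $e^{t\mathcal L^g_\gamma}$ be the Fourier multiplier on $\mathbb R^n$ with symbol $e^{-t|\xi|^\gamma/g(|\xi|)}$, with the convention that $-\Delta$ has symbol $|\xi|^2$; on Schwartz functions it is given by the Fourier integral. Suppose that the Fourier multiplier $G$ with symbol $g(|\xi|)$ is bounded on $L^p(\mathbb R^n)$, that is, $\|Gf\|_{L^p}\le C_G\|f\|_{L^p}$ for all $f\in L^p(\mathbb R^n)$. Then for every $t>0$ the operator $e^{t\mathcal L^g_\gamma}$ extends from the Schwartz functions to a bounded linear operator $H^{s_1,p}(\mathbb R^n)\to H^{s_2,p}(\mathbb R^n)$. Moreover, for every $t_0>0$ there is a constant $C$, which depends only on $n,p,s_1,s_2,\gamma,g,t_0$, such that for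 all $0<t\le t_0$ and all $f\in H^{s_1,p}(\mathbb R^n)$ $$\|e^{t\mathcal L^g_\gamma}f\|_{H^{s_2,p}}\le C\,t^{-(s_2-s_1)/\gamma}\,\|f\|_{H^{s_1,p}} .$$ Here $H^{s,p}(\mathbb R^n)$ is the Bessel potential space of tempered distributions $u$ for which the Bessel potential of order $s$ of $u$ is in $L^p$, normed by the $L^p$ norm of that function. -/

import Mathlib

open MeasureTheory Set TemperedDistribution
open scoped SchwartzMap FourierTransform ENNReal

noncomputable section

/-! ### Bessel potential (Sobolev) spaces `H^{s,p}(ℝⁿ)` as normed spaces -/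

/-- The submodule of tempered distributions `u` on `ℝⁿ` whose Bessel potential of order `s`
is (represented by) an `L^p` function. -/
def sobolevSubmodule (n : ℕ) (s : ℝ) (p : ℝ≥0∞) [Fact (1 ≤ p)] :
    Submodule ℂ 𝓢'(EuclideanSpace ℝ (Fin n), ℂ) where
  carrier := {u | MemSobolev s p u}
  add_mem' hu hv := hu.add hv
  zero_mem' := memSobolev_fun_zero _ _ s p
  smul_mem' c _ hu := hu.smul c

/-- The space `H^{s,p}(ℝⁿ)`. It is a type synonym, so that it carries the Sobolev norm below and
not the topology of the tempered distributions. -/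
def SobolevSpace (n : ℕ) (s : ℝ) (p : ℝ≥0∞) [Fact (1 ≤ p)] : Type :=
  ↥(sobolevSubmodule n s p)

namespace SobolevSpace

variable {n : ℕ} {s : ℝ} {p : ℝ≥0∞} [Fact (1 ≤ p)]

instance : AddCommGroup (SobolevSpace n s p) :=
  inferInstanceAs (AddCommGroup ↥(sobolevSubmodule n s p))

instance : Module ℂ (SobolevSpace n s p) :=
  inferInstanceAs (Module ℂ ↥(sobolevSubmodule n s p))

/-- The inclusion of `H^{s,p}` into the tempered distributions. -/
def toDistribution : SobolevSpace n s p →ₗ[ℂ] 𝓢'(EuclideanSpace ℝ (Fin n), ℂ) :=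
  (sobolevSubmodule n s p).subtype

theorem toDistribution_injective :
    Function.Injective (toDistribution : SobolevSpace n s p → _) :=
  Subtype.val_injective

theorem toTemperedDistribution_injective :
    Function.Injective (fun v : Lp ℂ p (volume : Measure (EuclideanSpace ℝ (Fin n))) =>
      (v : 𝓢'(EuclideanSpace ℝ (Fin n), ℂ))) :=
  LinearMap.ker_eq_bot.mp (Lp.ker_toTemperedDistributionCLM_eq_bot
    (F := ℂ) (μ := (volume : Measure (EuclideanSpace ℝ (Fin n)))) (p := p))

/-- The `L^p` function that represents the Bessel potential of order `s` of `u`. -/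
def besselLp (u : SobolevSpace n s p) :
    Lp ℂ p (volume : Measure (EuclideanSpace ℝ (Fin n))) :=
  Classical.choose (show MemSobolev s p (toDistribution u) from u.2)

theorem besselLp_spec (u : SobolevSpace n s p) :
    besselPotential _ ℂ s (toDistribution u) = (besselLp u : 𝓢'(EuclideanSpace ℝ (Fin n), ℂ)) :=
  Classical.choose_spec (show MemSobolev s p (toDistribution u) from u.2)

/-- `besselLp` is a linear map. -/
def besselLpLinear :
    SobolevSpace n s p →ₗ[ℂ] Lp ℂ p (volume : Measure (EuclideanSpace ℝ (Fin n))) where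
  toFun := besselLp
  map_add' u v := by
    apply toTemperedDistribution_injective
    simp only [← Lp.toTemperedDistributionCLM_apply, map_add]
    simp only [Lp.toTemperedDistributionCLM_apply, ← besselLp_spec, map_add]
  map_smul' c u := by
    apply toTemperedDistribution_injective
    simp only [← Lp.toTemperedDistributionCLM_apply, map_smul, RingHom.id_apply]
    simp only [Lp.toTemperedDistributionCLM_apply, ← besselLp_spec, map_smul]

theorem besselLpLinear_injective :
    Function.Injective (besselLpLinear : SobolevSpace n s p →ₗ[ℂ] _) := by
  intro u v h
  have h' : besselLp u = besselLp v := h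
  apply toDistribution_injective
  have h2 : besselPotential _ ℂ s (toDistribution u) = besselPotential _ ℂ s (toDistribution v) := by
    rw [besselLp_spec, besselLp_spec, h']
  have h3 := congrArg (besselPotential (EuclideanSpace ℝ (Fin n)) ℂ (-s)) h2
  simpa using h3

/-- The Sobolev norm: `‖u‖_{H^{s,p}}` is the `L^p` norm of the Bessel potential of order `s`
of `u`. -/
instance : NormedAddCommGroup (SobolevSpace n s p) :=
  NormedAddCommGroup.induced _ _ (besselLpLinear : SobolevSpace n s p →ₗ[ℂ] _)
    besselLpLinear_injective

instance : NormedSpace ℂ (SobolevSpace n s p) :=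
  NormedSpace.induced ℂ _ _ (besselLpLinear : SobolevSpace n s p →ₗ[ℂ] _)

theorem norm_eq (u : SobolevSpace n s p) : ‖u‖ = ‖besselLp u‖ := rfl

/-- A Schwartz function as an element of `H^{s,p}`. -/
def ofSchwartz (f : 𝓢(EuclideanSpace ℝ (Fin n), ℂ)) : SobolevSpace n s p :=
  ⟨(f : 𝓢'(EuclideanSpace ℝ (Fin n), ℂ)), f.memSobolev⟩

end SobolevSpace

/-! ### Fourier multipliers with symbols that need not be smooth -/

/-- `symbolMul m f` is the function `ξ ↦ m(2πξ) 𝓕f(ξ)`. The factor `2π` passes from Mathlib's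
Fourier transform (with `e^{-2πi⟨x,ξ⟩}`) to symbols for the convention with `e^{i⟨x,ξ⟩}`, for which
`-Δ` has the symbol `|ξ|²`. -/
def symbolMul {n : ℕ} (m : EuclideanSpace ℝ (Fin n) → ℂ)
    (f : 𝓢(EuclideanSpace ℝ (Fin n), ℂ)) : EuclideanSpace ℝ (Fin n) → ℂ :=
  fun ξ => m ((2 * Real.pi) • ξ) * (𝓕 f) ξ

/-- The Fourier multiplier with symbol `m` on a Schwartz function `f`:
`x ↦ ∫ m(η) f^(η) e^{i⟨x,η⟩} dη`, where `f^(η) = (2π)^{-n} ∫ f(y) e^{-i⟨y,η⟩} dy`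
(substitute `η = 2πξ`). -/
def multiplierApply {n : ℕ} (m : EuclideanSpace ℝ (Fin n) → ℂ)
    (f : 𝓢(EuclideanSpace ℝ (Fin n), ℂ)) : EuclideanSpace ℝ (Fin n) → ℂ :=
  𝓕⁻ (symbolMul m f)

/-- The Fourier multiplier with symbol `m` is bounded on `L^p(ℝⁿ)`: there is a bounded operator on
`L^p` that is given by the multiplier formula on all Schwartz functions for which the integral in
this formula converges absolutely. -/
def MultiplierBoundedOnLp {n : ℕ} (p : ℝ≥0∞) [Fact (1 ≤ p)]
    (m : EuclideanSpace ℝ (Fin n) → ℂ) : Prop :=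
  ∃ G : Lp ℂ p (volume : Measure (EuclideanSpace ℝ (Fin n))) →L[ℂ]
      Lp ℂ p (volume : Measure (EuclideanSpace ℝ (Fin n))),
    ∀ f : 𝓢(EuclideanSpace ℝ (Fin n), ℂ), Integrable (symbolMul m f) →
      G (f.toLp p) =ᵐ[volume] multiplierApply m f

/-- The operator `T : H^{s₁,p} → H^{s₂,p}` is the Fourier multiplier with symbol `m`: on every
Schwartz function `f` the defining integral converges absolutely and `T f` is, as a tempered
distribution, the function that it defines. As Schwartz functions are dense in `H^{s₁,p}` for
`p < ∞`, there is at most one such bounded operator. -/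
def IsFourierMultiplier {n : ℕ} {s₁ s₂ : ℝ} {p : ℝ≥0∞} [Fact (1 ≤ p)]
    (m : EuclideanSpace ℝ (Fin n) → ℂ)
    (T : SobolevSpace n s₁ p →L[ℂ] SobolevSpace n s₂ p) : Prop :=
  ∀ f : 𝓢(EuclideanSpace ℝ (Fin n), ℂ), Integrable (symbolMul m f) ∧
    ∀ φ : 𝓢(EuclideanSpace ℝ (Fin n), ℂ),
      (T (SobolevSpace.ofSchwartz f)).toDistribution φ = ∫ x, φ x * multiplierApply m f x

/-- The symbol `e^{-t|ξ|^γ / g(|ξ|)}` of `e^{tL}`. -/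
def semigroupSymbol {n : ℕ} (γ : ℝ) (g : ℝ → ℝ) (t : ℝ) (ξ : EuclideanSpace ℝ (Fin n)) : ℂ :=
  ((Real.exp (-t * ‖ξ‖ ^ γ / g ‖ξ‖) : ℝ) : ℂ)

/-- The condition on `g` that governs the kernel of `e^{tL}`:
`sup_{0<t<1} ∫_0^∞ |∂_r^{n+1} (r^{n-1} e^{-r^γ / g(r t^{-1/γ})})| dr < ∞`. -/
def KernelCondition (n : ℕ) (γ : ℝ) (g : ℝ → ℝ) : Prop :=
  (⨆ t ∈ Ioo (0 : ℝ) 1, ∫⁻ r in Ioi (0 : ℝ),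
    ‖iteratedDeriv (n + 1)
      (fun r : ℝ => r ^ (n - 1) * Real.exp (-r ^ γ / g (r * t ^ (-1 / γ)))) r‖ₑ) < ∞

end

/-! The boundedness of `G` on `L^p` is used only to see that `g` is bounded. Modulating a fixed bump
moves its frequency support arbitrarily far out without changing any `L^p` norm, so testing `G` on
such functions bounds the monotone `g` (`MultiplierBoundedOnLp.exists_le`). With `g ≤ B` the
semigroup symbol decays faster than every power of `|ξ|`.

It then suffices that `(1 + |ξ|²)^{σ/2}` times the symbol, `σ = s₂ - s₁`, is the Fourier transform
of a kernel with `L¹` norm `O(t^{-σ/γ})`. Convolution with this kernel is bounded on `L^p`, and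
conjugation by Bessel potentials turns it into an operator from `H^{s₁,p}` to `H^{s₂,p}`
(`exists_sobolev_fourierMultiplier`).

For `t < 1` the symbol is a dilate of `E(|ξ|)` with `E(r) = e^{-r^γ/g(r t^{-1/γ})}`, and the kernel
condition bounds the `L¹` norm of `∂^{n+1}(r^{n-1}E)` uniformly in `t`. The multiplier is cut into
dyadic annuli. On the annulus of scale `l` one knows a bound `A` for `H(r) = (lr)^{n-1}E(lr)` and
the bound `l^n M` for the `L¹` norm of its derivative of order `n + 1`. A Landau inequality supplies
the intermediate derivatives, and a Bernstein argument bounds the kernel by a multiple of `R^n A +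
(A + l^n M)/R` with `R > 0` free (`exists_hasKernelBound_annulus`). The derivative bound does not
decay in `l`, but `A` decays faster than every power, so a large power of `l` as `R` makes both
terms decay at any prescribed rate. At low frequencies `E - 1` replaces `E`: it is `O(r)` because `γ
> 1`, and the subtracted `r^{n-1}` is annihilated by `n + 1` derivatives, so these pieces are
geometrically small.

Times up to `t₀` are reached by writing the symbol at time `t` as the `N`-th power of the symbol at
time `t/N < 1`. -/

/-! ### Multipliers with an integrable kernel -/

section KernelMultipliers

variable {V : Type*} [NormedAddCommGroup V] [InnerProductSpace ℝ V] [FiniteDimensional ℝ V]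
  [MeasurableSpace V] [BorelSpace V]

/-- `M` is the Fourier transform of an integrable function of `L¹` norm at most `C`. -/
def HasKernelBound (M : V → ℂ) (C : ℝ) : Prop :=
  ∃ k : V → ℂ, Integrable k ∧ ∫ x, ‖k x‖ ≤ C ∧ ∀ ξ, 𝓕 k ξ = M ξ

theorem norm_fourier_le_integral_norm (k : V → ℂ) (ξ : V) : ‖𝓕 k ξ‖ ≤ ∫ x, ‖k x‖ :=
  VectorFourier.norm_fourierIntegral_le_integral_norm _ _ _ _ _

theorem integrable_fourierChar_smul {k : V → ℂ} (hk : Integrable k) (ξ : V) :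
    Integrable (fun v => Real.fourierChar (-(inner ℝ v ξ)) • k v) :=
  (VectorFourier.fourierIntegral_convergent_iff Real.continuous_fourierChar
    (L := innerₗ V) (by simpa using continuous_inner) ξ).2 hk

/-- Evaluation of the Fourier transform at a point, as a functional on `L¹`. -/
noncomputable def fourierEval (ξ : V) : (V →₁[volume] ℂ) →L[ℂ] ℂ :=
  LinearMap.mkContinuous
    { toFun := fun u => 𝓕 (u : V → ℂ) ξ
      map_add' := fun u v => by
        rw [Real.fourier_congr_ae (Lp.coeFn_add u v)]
        simp only [Real.fourier_eq, Pi.add_apply, smul_add]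
        exact integral_add (integrable_fourierChar_smul (L1.integrable_coeFn u) ξ)
          (integrable_fourierChar_smul (L1.integrable_coeFn v) ξ)
      map_smul' := fun c u => by
        rw [Real.fourier_congr_ae (Lp.coeFn_smul c u)]
        simp only [Real.fourier_eq, Pi.smul_apply, smul_comm _ c, RingHom.id_apply]
        exact integral_smul c _ }
    1 (fun u => by
      rw [one_mul, L1.norm_eq_integral_norm]
      exact norm_fourier_le_integral_norm _ _)

theorem fourierEval_toL1 {k : V → ℂ} (hk : Integrable k) (ξ : V) :
    fourierEval ξ (hk.toL1 k) = 𝓕 k ξ :=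
  Real.fourier_congr_ae hk.coeFn_toL1 ξ

namespace HasKernelBound

variable {M M' : V → ℂ} {C C' : ℝ}

theorem mono (h : HasKernelBound M C) (hC : C ≤ C') : HasKernelBound M C' := by
  obtain ⟨k, hk, hb, hM⟩ := h
  exact ⟨k, hk, hb.trans hC, hM⟩

theorem congr (h : HasKernelBound M C) (hM : ∀ ξ, M ξ = M' ξ) : HasKernelBound M' C := by
  obtain rfl : M = M' := funext hM
  exact h

theorem nonneg (h : HasKernelBound M C) : 0 ≤ C := by
  obtain ⟨k, hk, hb, hM⟩ := h
  exact (integral_nonneg fun _ => norm_nonneg _).trans hb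

theorem ofL1 (u : V →₁[volume] ℂ) (hM : ∀ ξ, fourierEval ξ u = M ξ) (hC : ‖u‖ ≤ C) :
    HasKernelBound M C :=
  ⟨u, L1.integrable_coeFn u, by rwa [← L1.norm_eq_integral_norm], hM⟩

theorem exists_L1 (h : HasKernelBound M C) :
    ∃ u : V →₁[volume] ℂ, (∀ ξ, fourierEval ξ u = M ξ) ∧ ‖u‖ ≤ C := by
  obtain ⟨k, hk, hb, hM⟩ := h
  refine ⟨hk.toL1 k, fun ξ => (fourierEval_toL1 hk ξ).trans (hM ξ), ?_⟩
  rwa [L1.norm_of_fun_eq_integral_norm]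

theorem const_mul (h : HasKernelBound M C) (c : ℂ) :
    HasKernelBound (fun ξ => c * M ξ) (‖c‖ * C) := by
  obtain ⟨u, hu, hC⟩ := h.exists_L1
  refine ofL1 (c • u) (fun ξ => by simp [hu]) ?_
  rw [norm_smul]
  gcongr

theorem add (h : HasKernelBound M C) (h' : HasKernelBound M' C') :
    HasKernelBound (fun ξ => M ξ + M' ξ) (C + C') := by
  obtain ⟨u, hu, hC⟩ := h.exists_L1
  obtain ⟨v, hv, hC'⟩ := h'.exists_L1
  exact ofL1 (u + v) (fun ξ => by simp [hu, hv]) ((norm_add_le _ _).trans (add_le_add hC hC'))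

/-- `L¹` is complete and evaluation of the Fourier transform at a point is continuous on it, so
pointwise convergence of the symbols identifies the transform of the summed kernels. This
reassembles the dyadic pieces. -/
theorem hasSum {ι : Type*} {m : ι → V → ℂ} {c : ι → ℝ} (h : ∀ i, HasKernelBound (m i) (c i))
    (hc : HasSum c C) (hm : ∀ ξ, HasSum (fun i => m i ξ) (M ξ)) : HasKernelBound M C := by
  choose u hu hC using fun i => (h i).exists_L1
  have hs : Summable u := Summable.of_norm_bounded hc.summable hC
  refine ofL1 (∑' i, u i) (fun ξ => ?_) (tsum_of_norm_bounded hc hC)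
  have := (hs.hasSum.mapL (fourierEval ξ))
  simp only [hu] at this
  exact this.unique (hm ξ)

/-- The kernel of a product is the convolution of the kernels, and `‖k * k'‖₁ ≤ ‖k‖₁ ‖k'‖₁`. -/
theorem mul (h : HasKernelBound M C) (h' : HasKernelBound M' C') :
    HasKernelBound (fun ξ => M ξ * M' ξ) (C * C') := by
  have hC := h.nonneg
  obtain ⟨k, hk, hb, hM⟩ := h
  obtain ⟨k', hk', hb', hM'⟩ := h'
  refine ⟨convolution k k' (ContinuousLinearMap.mul ℂ ℂ) volume,
    hk.integrable_convolution _ hk', ?_, fun ξ => by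
      rw [Real.fourier_mul_convolution_eq hk hk', hM, hM']⟩
  set K : V → ℝ := convolution (fun x => ‖k x‖) (fun x => ‖k' x‖) (ContinuousLinearMap.mul ℝ ℝ)
    volume with hK
  have key : ∫ x, K x = (∫ x, ‖k x‖) * ∫ x, ‖k' x‖ := by
    rw [hK, integral_convolution _ hk.norm hk'.norm]
    rfl
  calc _ ≤ ∫ x, K x := by
        refine integral_mono (hk.integrable_convolution _ hk').norm
          (hk.norm.integrable_convolution _ hk'.norm) fun x => ?_
        refine (norm_integral_le_integral_norm _).trans (le_of_eq ?_)
        simp [hK, convolution]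
    _ ≤ C * C' := by
        rw [key]
        gcongr

theorem one_pow_mul (h : HasKernelBound M C) (h' : HasKernelBound M' C') (N : ℕ) :
    HasKernelBound (fun ξ => M' ξ ^ N * M ξ) (C' ^ N * C) := by
  induction N with
  | zero => simpa using h
  | succ N ih =>
    refine ((h'.mul ih).congr fun ξ => ?_).mono (le_of_eq ?_) <;> ring

/-- Dilating the symbol rescales the kernel without changing its `L¹` norm, so every dyadic piece
can be estimated on the unit annulus. -/
theorem comp_smul (h : HasKernelBound M C) {c : ℝ} (hc : 0 < c) :
    HasKernelBound (fun ξ => M (c • ξ)) C := by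
  obtain ⟨k, hk, hb, hM⟩ := h
  set d := Module.finrank ℝ V
  have hcd : 0 < c ^ d := by positivity
  refine ⟨fun x => ((c ^ d)⁻¹ : ℝ) • k (c⁻¹ • x), ?_, ?_, fun ξ => ?_⟩
  · exact (hk.comp_smul (inv_ne_zero hc.ne')).smul ((c ^ d)⁻¹ : ℝ)
  · simp only [norm_smul]
    rw [integral_const_mul, Measure.integral_comp_inv_smul_of_nonneg volume (fun x => ‖k x‖) hc.le]
    simp only [norm_inv, norm_pow, Real.norm_eq_abs, abs_of_pos hc, smul_eq_mul]
    rwa [inv_mul_cancel_left₀ hcd.ne']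
  · beta_reduce
    rw [← hM, Real.fourier_eq, Real.fourier_eq]
    have := Measure.integral_comp_inv_smul_of_nonneg volume
      (fun v => Real.fourierChar (-(inner ℝ v (c • ξ))) • k v) hc.le
    rw [← inv_smul_eq_iff₀ hcd.ne'] at this
    rw [← this, ← integral_smul]
    congr 1
    ext v
    rw [smul_comm]
    simp [inner_smul_left, inner_smul_right, hc.ne']

theorem ofSchwartz (f : 𝓢(V, ℂ)) : ∃ C, HasKernelBound (fun ξ => f ξ) C :=
  ⟨_, (𝓕⁻ f : 𝓢(V, ℂ)), (𝓕⁻ f : 𝓢(V, ℂ)).integrable, le_rfl, fun ξ => by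
    rw [← SchwartzMap.fourier_coe, FourierTransform.fourier_fourierInv_eq]⟩

end HasKernelBound

end KernelMultipliers

/-! ### Bernstein criterion for compactly supported symbols -/

section CompactSupport

variable {V : Type*} [NormedAddCommGroup V] [InnerProductSpace ℝ V] [FiniteDimensional ℝ V]
  [MeasurableSpace V] [BorelSpace V]

/-- A Bernstein type criterion, with a free scale parameter `R`. -/
theorem exists_hasKernelBound_of_hasCompactSupport {d : ℕ} (hd : Module.finrank ℝ V = d) :
    ∃ c : ℝ, 0 ≤ c ∧ ∀ (f : V → ℂ) (A B R : ℝ), ContDiff ℝ ((d + 1 : ℕ) : ℕ∞) f →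
      HasCompactSupport f → ∫ x, ‖f x‖ ≤ A →
      (∀ p ≤ d + 1, ∫ x, ‖iteratedFDeriv ℝ p f x‖ ≤ B) → 0 < R →
      HasKernelBound f (c * (R ^ d * A + B / R)) := by
  set I : ℝ := ∫ x : V, (1 + ‖x‖) ^ (-(d + 1 : ℝ)) with hI
  have hI0 : 0 ≤ I := integral_nonneg fun x => by positivity
  have hint : Integrable (fun x : V => (1 + ‖x‖) ^ (-(d + 1 : ℝ))) :=
    integrable_one_add_norm (by rw [hd]; linarith)
  refine ⟨2 ^ d * (2 ^ (d + 1) * (d + 2)) * I, by positivity, ?_⟩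
  intro f A B R hf hsupp hA hB hR
  have hfi : Integrable f := hf.continuous.integrable_of_hasCompactSupport hsupp
  have hA0 : 0 ≤ A := (integral_nonneg fun _ => norm_nonneg _).trans hA
  have hB0 : 0 ≤ B := (integral_nonneg fun _ => norm_nonneg _).trans (hB 0 (by omega))
  -- The factor `2 ^ (d + 1)` comes from the Fourier decay estimate, and `d + 2` counts the
  -- derivatives of order `0, …, d + 1`.
  set q : ℝ := 2 ^ (d + 1) * (d + 2) with hq
  have hq1 : 1 ≤ q := by
    have : (1 : ℝ) ≤ 2 ^ (d + 1) := one_le_pow₀ (by norm_num)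
    have : (0 : ℝ) ≤ d := by positivity
    nlinarith
  have hk0 : ∀ x, ‖𝓕 f x‖ ≤ A := fun x => (norm_fourier_le_integral_norm f x).trans hA
  have hk1 : ∀ x, ‖x‖ ^ (d + 1) * ‖𝓕 f x‖ ≤ q * B := by
    intro x
    have h := Real.pow_mul_norm_iteratedFDeriv_fourier_le (K := 0) (N := ((d + 1 : ℕ) : ℕ∞))
      (f := f) hf (fun k n hk hn => by
        have hk0 : k = 0 := by simpa using hk
        subst hk0
        simp only [pow_zero, one_mul]
        refine ((hf.continuous_iteratedFDeriv (by exact_mod_cast hn)).integrable_of_hasCompactSupport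
          (hsupp.iteratedFDeriv n)).norm) (k := 0) (n := d + 1) le_rfl le_rfl x
    simp only [norm_iteratedFDeriv_zero, pow_zero, one_mul, CharP.cast_eq_zero, mul_zero, zero_add,
      Finset.range_one, Finset.sum_product, Finset.sum_singleton] at h
    refine h.trans ?_
    have : ∑ p ∈ Finset.range (d + 1 + 1), ∫ v, ‖iteratedFDeriv ℝ p f v‖ ≤ (d + 2) * B := by
      refine (Finset.sum_le_card_nsmul _ _ B fun p hp => hB p ?_).trans (le_of_eq ?_)
      · have := Finset.mem_range.1 hp
        omega
      · simp only [Finset.card_range, nsmul_eq_mul]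
        push_cast
        ring
    rw [hq, mul_assoc]
    gcongr
  set K : ℝ := 2 ^ d * (q * (A + B / R ^ (d + 1))) with hK
  -- The bound `A` governs `|x| ≤ R` and the decay `B/|x|^{d+1}` governs `|x| ≥ R`. Integrating this
  -- common majorant gives the factor `R^d`, and `R^d (A + B/R^{d+1}) = R^d A + B/R`.
  have hpt : ∀ x, ‖𝓕 f x‖ ≤ K * (1 + ‖R⁻¹ • x‖) ^ (-(d + 1 : ℝ)) := by
    intro x
    have hy : ‖R⁻¹ • x‖ = ‖x‖ / R := by
      rw [norm_smul, norm_inv, Real.norm_of_nonneg hR.le]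
      field_simp
    rw [hy, Real.rpow_neg (by positivity), ← div_eq_mul_inv, le_div_iff₀ (by positivity)]
    have h1 : (1 + ‖x‖ / R) ^ (d + 1 : ℝ) = (1 + ‖x‖ / R) ^ (d + 1) := by
      exact_mod_cast Real.rpow_natCast (1 + ‖x‖ / R) (d + 1)
    rw [h1]
    have h2 := add_pow_le (zero_le_one' ℝ) (by positivity : 0 ≤ ‖x‖ / R) (d + 1)
    simp only [one_pow, Nat.add_sub_cancel] at h2
    have h3 : ‖𝓕 f x‖ * (‖x‖ / R) ^ (d + 1) ≤ q * (B / R ^ (d + 1)) := by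
      rw [div_pow, ← mul_div_assoc, ← mul_div_assoc, mul_comm]
      exact div_le_div_of_nonneg_right (hk1 x) (by positivity)
    have h4 : ‖𝓕 f x‖ ≤ q * A := (hk0 x).trans (by nlinarith)
    calc ‖𝓕 f x‖ * (1 + ‖x‖ / R) ^ (d + 1)
        ≤ ‖𝓕 f x‖ * (2 ^ d * (1 + (‖x‖ / R) ^ (d + 1))) := by gcongr
      _ = 2 ^ d * (‖𝓕 f x‖ + ‖𝓕 f x‖ * (‖x‖ / R) ^ (d + 1)) := by ring
      _ ≤ 2 ^ d * (q * A + q * (B / R ^ (d + 1))) := by gcongr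
      _ = K := by rw [hK]; ring
  have hdom : Integrable (fun x : V => K * (1 + ‖R⁻¹ • x‖) ^ (-(d + 1 : ℝ))) :=
    (hint.comp_smul (inv_ne_zero hR.ne')).const_mul K
  have hcont : Continuous (𝓕 f) :=
    VectorFourier.fourierIntegral_continuous Real.continuous_fourierChar
      (by simpa using continuous_inner) hfi
  have hFint : Integrable (𝓕 f) :=
    hdom.mono' hcont.aestronglyMeasurable (Filter.Eventually.of_forall hpt)
  have hval : ∫ x, ‖𝓕 f x‖ ≤ 2 ^ d * (2 ^ (d + 1) * (d + 2)) * I * (R ^ d * A + B / R) := by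
    refine (integral_mono hFint.norm hdom hpt).trans (le_of_eq ?_)
    rw [integral_const_mul, Measure.integral_comp_inv_smul_of_nonneg volume
      (fun x : V => (1 + ‖x‖) ^ (-(d + 1 : ℝ))) hR.le, hd, hK, ← hI, smul_eq_mul, hq, pow_succ R]
    field_simp
  refine ⟨𝓕⁻ f, ?_, ?_, ?_⟩
  · have : 𝓕⁻ f = fun x => 𝓕 f (-x) := funext fun x => Real.fourierInv_eq_fourier_neg f x
    rw [this]
    exact hFint.comp_neg
  · simp only [Real.fourierInv_eq_fourier_neg]
    rwa [integral_neg_eq_self (fun x => ‖𝓕 f x‖) volume]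
  · intro ξ
    rw [hf.continuous.fourier_fourierInv_eq hfi hFint]

end CompactSupport

/-! ### Landau inequalities on an interval -/

section Interpolation

variable {n : ℕ} {H : ℝ → ℝ}

theorem ContDiffOn.differentiableOn_iteratedDeriv_of_isOpen {s : Set ℝ} (hs : IsOpen s) {N k : ℕ}
    (hH : ContDiffOn ℝ (N : ℕ∞) H s) (hk : k < N) : DifferentiableOn ℝ (iteratedDeriv k H) s :=
  (hH.differentiableOn_iteratedDerivWithin (by exact_mod_cast hk) hs.uniqueDiffOn).congr
    fun _ hx => (iteratedDerivWithin_of_isOpen hs hx).symm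

theorem ContDiffOn.continuousOn_iteratedDeriv_of_isOpen {s : Set ℝ} (hs : IsOpen s) {N k : ℕ}
    (hH : ContDiffOn ℝ (N : ℕ∞) H s) (hk : k ≤ N) : ContinuousOn (iteratedDeriv k H) s :=
  (hH.continuousOn_iteratedDerivWithin (by exact_mod_cast hk) hs.uniqueDiffOn).congr
    fun _ hx => (iteratedDerivWithin_of_isOpen hs hx).symm

/-- A function bounded by `A` on an interval has its `k`-th derivative bounded by a multiple of `A`
somewhere in the interval. -/
theorem exists_abs_iteratedDeriv_le (k : ℕ) : ∀ L : ℝ, 0 < L → ∃ C : ℝ, 0 ≤ C ∧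
    ∀ (H : ℝ → ℝ) (x A : ℝ), ContDiffOn ℝ (k : ℕ∞) H (Ioi 0) → 0 < x →
      (∀ y ∈ Icc x (x + L), |H y| ≤ A) →
      ∃ ξ ∈ Icc x (x + L), |iteratedDeriv k H ξ| ≤ C * A := by
  induction k with
  | zero =>
    intro L hL
    refine ⟨1, zero_le_one, fun H x A _ _ hA => ⟨x, ⟨le_rfl, by linarith⟩, ?_⟩⟩
    simpa using hA x ⟨le_rfl, by linarith⟩
  | succ k ih =>
    intro L hL
    -- Good points for order `k` in the two outer thirds are at least `L / 3` apart, so the mean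
    -- value theorem between them gives a good point for order `k + 1`.
    obtain ⟨C, hC, h⟩ := ih (L / 3) (by positivity)
    refine ⟨2 * C / (L / 3), by positivity, fun H x A hH hx hA => ?_⟩
    have hH' : ContDiffOn ℝ (k : ℕ∞) H (Ioi 0) :=
      hH.of_le (by exact_mod_cast Nat.le_succ k)
    obtain ⟨a, ha, hHa⟩ := h H x A hH' hx fun y hy => hA y ⟨hy.1, by linarith [hy.2]⟩
    obtain ⟨b, hb, hHb⟩ := h H (x + 2 * (L / 3)) A hH' (by positivity) fun y hy =>
      hA y ⟨by linarith [hy.1], by linarith [hy.2]⟩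
    have hab : L / 3 ≤ b - a := by linarith [ha.2, hb.1]
    have hlt : a < b := by linarith
    have hd := hH.differentiableOn_iteratedDeriv_of_isOpen isOpen_Ioi (Nat.lt_succ_self k)
    have hsub : Icc a b ⊆ Ioi 0 := fun y hy => lt_of_lt_of_le hx (ha.1.trans hy.1)
    obtain ⟨ξ, hξ, hξ'⟩ := exists_deriv_eq_slope (iteratedDeriv k H) hlt
      (hd.continuousOn.mono hsub) (hd.mono (Ioo_subset_Icc_self.trans hsub))
    refine ⟨ξ, ⟨ha.1.trans hξ.1.le, by linarith [hξ.2, hb.2]⟩, ?_⟩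
    rw [iteratedDeriv_succ, hξ', abs_div, abs_of_pos (by linarith : 0 < b - a)]
    have h1 : |iteratedDeriv k H b - iteratedDeriv k H a| ≤ 2 * (C * A) :=
      (abs_sub _ _).trans (by linarith)
    have h0 : 0 ≤ C * A := (abs_nonneg _).trans hHa
    calc _ ≤ 2 * (C * A) / (L / 3) := by gcongr
      _ = _ := by ring

/-- A Landau type inequality on the interval `[1/2, 2]`. -/
theorem exists_abs_iteratedDeriv_le_add (n : ℕ) : ∃ C : ℝ, 0 ≤ C ∧
    ∀ (H : ℝ → ℝ) (A D : ℝ), ContDiffOn ℝ ((n + 1 : ℕ) : ℕ∞) H (Ioi 0) →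
      (∀ y ∈ Icc (1 / 2 : ℝ) 2, |H y| ≤ A) →
      ∫ y in Icc (1 / 2 : ℝ) 2, |iteratedDeriv (n + 1) H y| ≤ D →
      ∀ k ≤ n, ∀ y ∈ Icc (1 / 2 : ℝ) 2, |iteratedDeriv k H y| ≤ C * (A + D) := by
  have hsub : Icc (1 / 2 : ℝ) 2 ⊆ Ioi 0 := fun y hy =>
    lt_of_lt_of_le (by norm_num : (0 : ℝ) < 1 / 2) hy.1
  choose C₀ hC₀ h₀ using fun k => exists_abs_iteratedDeriv_le k (3 / 2) (by norm_num)
  -- Descending induction on the order: the integral of the derivative of order `n + 1` controls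
  -- order `n`, and a sup bound for each order then controls the one below. Each time the start is a
  -- point where the derivative is known to be small.
  suffices key : ∀ j ≤ n, ∃ C : ℝ, 0 ≤ C ∧
      ∀ (H : ℝ → ℝ) (A D : ℝ), ContDiffOn ℝ ((n + 1 : ℕ) : ℕ∞) H (Ioi 0) →
        (∀ y ∈ Icc (1 / 2 : ℝ) 2, |H y| ≤ A) →
        ∫ y in Icc (1 / 2 : ℝ) 2, |iteratedDeriv (n + 1) H y| ≤ D →
        ∀ y ∈ Icc (1 / 2 : ℝ) 2, |iteratedDeriv (n - j) H y| ≤ C * (A + D) by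
    choose! C hC h using key
    refine ⟨∑ j ∈ Finset.range (n + 1), C j, Finset.sum_nonneg fun j hj => hC j ?_, ?_⟩
    · have := Finset.mem_range.1 hj
      omega
    intro H A D hH hA hD k hk y hy
    have hA0 : 0 ≤ A := (abs_nonneg _).trans (hA y hy)
    have hD0 : 0 ≤ D := (integral_nonneg fun _ => abs_nonneg _).trans hD
    have h1 := h (n - k) (Nat.sub_le _ _) H A D hH hA hD y hy
    rw [Nat.sub_sub_self hk] at h1
    refine h1.trans ?_
    gcongr
    exact Finset.single_le_sum (f := C) (fun j hj => hC j (by have := Finset.mem_range.1 hj; omega))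
      (Finset.mem_range.2 (by omega))
  have hpt : ∀ k ≤ n, ∀ (H : ℝ → ℝ) (A : ℝ), ContDiffOn ℝ ((n + 1 : ℕ) : ℕ∞) H (Ioi 0) →
      (∀ y ∈ Icc (1 / 2 : ℝ) 2, |H y| ≤ A) →
      ∃ ξ ∈ Icc (1 / 2 : ℝ) 2, |iteratedDeriv k H ξ| ≤ C₀ k * A := by
    intro k hk H A hH hA
    have := h₀ k H (1 / 2) A (hH.of_le (by exact_mod_cast hk.trans (Nat.le_succ n)))
      (by norm_num)
    norm_num at this hA ⊢
    exact this hA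
  intro j
  induction j with
  | zero =>
    intro _
    refine ⟨C₀ n + 1, by linarith [hC₀ n], fun H A D hH hA hD y hy => ?_⟩
    obtain ⟨ξ, hξ, hle⟩ := hpt n le_rfl H A hH hA
    have hD0 : 0 ≤ D := (integral_nonneg fun _ => abs_nonneg _).trans hD
    have hA0 : 0 ≤ A := (abs_nonneg _).trans (hA y hy)
    have hI : uIcc ξ y ⊆ Icc (1 / 2 : ℝ) 2 := uIcc_subset_Icc hξ hy
    have hcont := hH.continuousOn_iteratedDeriv_of_isOpen isOpen_Ioi (le_refl (n + 1))
    have hd := hH.differentiableOn_iteratedDeriv_of_isOpen isOpen_Ioi (Nat.lt_succ_self n)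
    have hftc : ∫ t in ξ..y, iteratedDeriv (n + 1) H t
        = iteratedDeriv n H y - iteratedDeriv n H ξ := by
      simp only [iteratedDeriv_succ] at hcont ⊢
      refine intervalIntegral.integral_deriv_eq_sub (fun t ht =>
        (hd t (hsub (hI ht))).differentiableAt (Ioi_mem_nhds (hsub (hI ht)))) ?_
      exact (hcont.mono (hI.trans hsub)).intervalIntegrable
    have h1 : |iteratedDeriv n H y - iteratedDeriv n H ξ| ≤ D := by
      rw [← hftc]
      refine (intervalIntegral.norm_integral_le_integral_norm_uIoc (E := ℝ)).trans (le_trans ?_ hD)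
      refine setIntegral_mono_set ?_ (Filter.Eventually.of_forall fun _ => abs_nonneg _)
        (uIoc_subset_uIcc.trans hI).eventuallyLE
      exact (hcont.abs.mono hsub).integrableOn_Icc
    have h2 : |iteratedDeriv n H y| ≤ D + C₀ n * A := by
      have := abs_sub_abs_le_abs_sub (iteratedDeriv n H y) (iteratedDeriv n H ξ)
      linarith
    simp only [Nat.sub_zero]
    nlinarith [hC₀ n, mul_nonneg (hC₀ n) hD0]
  | succ j ih =>
    intro hj
    obtain ⟨C, hC, h⟩ := ih (by omega)
    refine ⟨C₀ (n - (j + 1)) + C * 2, add_nonneg (hC₀ _) (by positivity),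
      fun H A D hH hA hD y hy => ?_⟩
    obtain ⟨ξ, hξ, hle⟩ := hpt (n - (j + 1)) (Nat.sub_le _ _) H A hH hA
    have hD0 : 0 ≤ D := (integral_nonneg fun _ => abs_nonneg _).trans hD
    have hA0 : 0 ≤ A := (abs_nonneg _).trans (hA y hy)
    have hd := hH.differentiableOn_iteratedDeriv_of_isOpen isOpen_Ioi
      (show n - (j + 1) < n + 1 by omega)
    have hk : n - (j + 1) + 1 = n - j := by omega
    have h1 := (convex_Icc (1 / 2 : ℝ) 2).norm_image_sub_le_of_norm_deriv_le (𝕜 := ℝ)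
      (f := iteratedDeriv (n - (j + 1)) H) (C := C * (A + D))
      (fun t ht => (hd t (hsub ht)).differentiableAt (Ioi_mem_nhds (hsub ht)))
      (fun t ht => by
        rw [← iteratedDeriv_succ, hk]
        exact h H A D hH hA hD t ht) hξ hy
    simp only [Real.norm_eq_abs] at h1
    have h3 : |y - ξ| ≤ 2 := by
      rw [abs_le]
      constructor <;> linarith [hξ.1, hξ.2, hy.1, hy.2]
    have h4 : C * (A + D) * |y - ξ| ≤ C * (A + D) * 2 := by gcongr
    have := abs_sub_abs_le_abs_sub (iteratedDeriv (n - (j + 1)) H y)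
      (iteratedDeriv (n - (j + 1)) H ξ)
    nlinarith [mul_nonneg (hC₀ (n - (j + 1))) hD0]

end Interpolation

/-! ### Radial symbols supported in an annulus -/

section Radial

variable {V : Type*} [NormedAddCommGroup V] [InnerProductSpace ℝ V] [FiniteDimensional ℝ V]

variable (V) in
-- The norm is smooth off the origin and the closed annulus is compact. The normalization `1 ≤ C`
-- allows `C ≤ C ^ i`, the form needed in the chain rule estimate.
theorem exists_norm_iteratedFDeriv_norm_le (N : ℕ) : ∃ C : ℝ, 1 ≤ C ∧
    ∀ i ≤ N, ∀ ξ : V, ‖ξ‖ ∈ Icc (1 / 2 : ℝ) 2 →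
      ‖iteratedFDerivWithin ℝ i (fun x : V => ‖x‖) {0}ᶜ ξ‖ ≤ C := by
  have hK : IsCompact {ξ : V | ‖ξ‖ ∈ Icc (1 / 2 : ℝ) 2} := by
    refine Metric.isCompact_of_isClosed_isBounded (isClosed_Icc.preimage continuous_norm) ?_
    exact (Metric.isBounded_closedBall (x := (0 : V)) (r := 2)).subset fun ξ hξ => by
      simpa using (hξ : ‖ξ‖ ∈ Icc (1 / 2 : ℝ) 2).2
  have hsub : {ξ : V | ‖ξ‖ ∈ Icc (1 / 2 : ℝ) 2} ⊆ {0}ᶜ := by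
    rintro ξ hξ rfl
    have := (hξ : ‖(0 : V)‖ ∈ Icc (1 / 2 : ℝ) 2).1
    norm_num at this
  have hsm : ContDiffOn ℝ (N : ℕ∞) (fun x : V => ‖x‖) {0}ᶜ := fun x hx =>
    (contDiffAt_norm ℝ hx).contDiffWithinAt
  have h : ∀ i, ∃ C : ℝ, i ≤ N → ∀ ξ : V, ‖ξ‖ ∈ Icc (1 / 2 : ℝ) 2 →
      ‖iteratedFDerivWithin ℝ i (fun x : V => ‖x‖) {0}ᶜ ξ‖ ≤ C := by
    intro i
    by_cases hi : i ≤ N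
    · obtain ⟨C, hC⟩ := hK.exists_bound_of_continuousOn
        ((hsm.continuousOn_iteratedFDerivWithin (m := i) (by exact_mod_cast hi)
          isOpen_compl_singleton.uniqueDiffOn).mono hsub)
      exact ⟨C, fun _ ξ hξ => hC ξ hξ⟩
    · exact ⟨0, fun h => absurd h hi⟩
  choose C hC using h
  refine ⟨1 + ∑ i ∈ Finset.range (N + 1), |C i|, by
    linarith [Finset.sum_nonneg fun i (_ : i ∈ Finset.range (N + 1)) => abs_nonneg (C i)], ?_⟩
  intro i hi ξ hξ
  have := Finset.single_le_sum (f := fun i => |C i|) (fun j _ => abs_nonneg (C j))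
    (Finset.mem_range.2 (by omega : i < N + 1))
  linarith [hC i hi ξ hξ, le_abs_self (C i)]

variable [MeasurableSpace V] [BorelSpace V]

variable (V) in
-- Polar coordinates, with the weight `r ^ (d - 1)` at most `2 ^ (d - 1)` on the annulus.
theorem integral_indicator_norm_le [Nontrivial V] {φ : ℝ → ℝ} (hφ : IntegrableOn φ (Icc (1 / 2 : ℝ) 2))
    (h0 : ∀ r ∈ Icc (1 / 2 : ℝ) 2, 0 ≤ φ r) :
    Integrable (fun ξ : V => (Icc (1 / 2 : ℝ) 2).indicator φ ‖ξ‖) ∧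
    ∫ ξ : V, (Icc (1 / 2 : ℝ) 2).indicator φ ‖ξ‖ ≤
      Module.finrank ℝ V * volume.real (Metric.ball (0 : V) 1) * 2 ^ (Module.finrank ℝ V - 1) *
        ∫ r in Icc (1 / 2 : ℝ) 2, φ r := by
  set d := Module.finrank ℝ V
  set I := Icc (1 / 2 : ℝ) 2 with hI
  have hsub : I ⊆ Ioi 0 := fun y hy => lt_of_lt_of_le (by norm_num : (0 : ℝ) < 1 / 2) hy.1
  have hind : ∀ y : ℝ, y ^ (d - 1) • I.indicator φ y = I.indicator (fun y => y ^ (d - 1) * φ y) y := by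
    intro y
    by_cases hy : y ∈ I <;> simp [hy]
  have hmul : IntegrableOn (fun y => y ^ (d - 1) * φ y) I :=
    hφ.continuousOn_mul (by fun_prop) isCompact_Icc
  constructor
  · rw [integrable_fun_norm_addHaar volume (f := I.indicator φ)]
    simp only [d, hind] at *
    exact ((integrable_indicator_iff measurableSet_Icc).2 hmul).integrableOn
  · rw [integral_fun_norm_addHaar volume (I.indicator φ)]
    have : ∫ y in Ioi (0 : ℝ), y ^ (d - 1) • I.indicator φ y
        ≤ 2 ^ (d - 1) * ∫ r in I, φ r := by
      simp only [hind]
      rw [setIntegral_indicator measurableSet_Icc, inter_eq_right.2 hsub, ← integral_const_mul]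
      refine setIntegral_mono_on hmul (hφ.const_mul _) measurableSet_Icc fun y hy => ?_
      have := h0 y hy
      have hy0 : 0 ≤ y := (hsub hy).le
      gcongr
      exact hy.2
    simp only [nsmul_eq_mul, smul_eq_mul]
    calc _ ≤ (d : ℝ) * (volume.real (Metric.ball (0 : V) 1) * (2 ^ (d - 1) * ∫ r in I, φ r)) := by
          gcongr
          simpa only [smul_eq_mul] using this
      _ = _ := by ring

theorem abs_iteratedDeriv_mul_le {W H : ℝ → ℝ} {N : ℕ} {Cw G x : ℝ} (hx : 0 < x) (hCw : 0 ≤ Cw)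
    (hW : ContDiff ℝ (N : ℕ∞) W) (hH : ContDiffOn ℝ (N : ℕ∞) H (Ioi 0))
    (hWb : ∀ k ≤ N, |iteratedDeriv k W x| ≤ Cw) (hHb : ∀ k ≤ N, |iteratedDeriv k H x| ≤ G)
    {i : ℕ} (hi : i ≤ N) :
    ‖iteratedFDerivWithin ℝ i (fun y => W y * H y) (Ioi 0) x‖ ≤ 2 ^ N * (Cw * G) := by
  have hG : 0 ≤ G := (abs_nonneg _).trans (hHb 0 (Nat.zero_le _))
  have e : ∀ (F : ℝ → ℝ) (k : ℕ),
      ‖iteratedFDerivWithin ℝ k F (Ioi 0) x‖ = |iteratedDeriv k F x| := by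
    intro F k
    rw [norm_iteratedFDerivWithin_eq_norm_iteratedDerivWithin,
      iteratedDerivWithin_of_isOpen isOpen_Ioi hx, Real.norm_eq_abs]
  have h := norm_iteratedFDerivWithin_mul_le hW.contDiffOn hH isOpen_Ioi.uniqueDiffOn hx (n := i)
    (by exact_mod_cast hi)
  refine h.trans ?_
  calc _ ≤ ∑ j ∈ Finset.range (i + 1), (i.choose j : ℝ) * (Cw * G) := by
        refine Finset.sum_le_sum fun j hj => ?_
        have := Finset.mem_range.1 hj
        rw [e, e, mul_assoc]
        gcongr
        · exact hWb j (by omega)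
        · exact hHb (i - j) (by omega)
    _ = 2 ^ i * (Cw * G) := by
        rw [← Finset.sum_mul]
        congr 1
        exact_mod_cast Nat.sum_range_choose i
    _ ≤ _ := by
        gcongr
        norm_num

/-- Kernel bound for a radial multiplier supported in an annulus. -/
theorem exists_hasKernelBound_annulus [Nontrivial V] {d : ℕ} (hd : Module.finrank ℝ V = d) :
    ∃ c : ℝ, 0 ≤ c ∧ ∀ (W H : ℝ → ℝ) (Cw A D R : ℝ), ContDiff ℝ ((d + 1 : ℕ) : ℕ∞) W →
      (∀ r, r ∉ Icc (1 / 2 : ℝ) 2 → W r = 0) →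
      (∀ k ≤ d + 1, ∀ r ∈ Icc (1 / 2 : ℝ) 2, |iteratedDeriv k W r| ≤ Cw) →
      ContDiffOn ℝ ((d + 1 : ℕ) : ℕ∞) H (Ioi 0) →
      (∀ r ∈ Icc (1 / 2 : ℝ) 2, |H r| ≤ A) →
      ∫ r in Icc (1 / 2 : ℝ) 2, |iteratedDeriv (d + 1) H r| ≤ D → 0 < R →
      HasKernelBound (fun ξ : V => ((W ‖ξ‖ * H ‖ξ‖ : ℝ) : ℂ))
        (c * Cw * (R ^ d * A + (A + D) / R)) := by
  obtain ⟨c₁, hc₁, hkern⟩ := exists_hasKernelBound_of_hasCompactSupport (V := V) hd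
  obtain ⟨c₂, hc₂, hland⟩ := exists_abs_iteratedDeriv_le_add d
  obtain ⟨c₃, hc₃, hnorm⟩ := exists_norm_iteratedFDeriv_norm_le V (d + 1)
  set c₄ : ℝ := Module.finrank ℝ V * volume.real (Metric.ball (0 : V) 1) *
    2 ^ (Module.finrank ℝ V - 1) with hc₄
  have hc₄0 : 0 ≤ c₄ := by positivity
  set K : ℝ := (d + 1).factorial * 2 ^ (d + 1) * c₃ ^ (d + 1) with hK
  have hK0 : 0 ≤ K := by positivity
  refine ⟨c₁ * (c₄ * (2 + K * (2 * c₂ + 1))), by positivity, ?_⟩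
  intro W H Cw A D R hW hsupp hWb hH hA hD hR
  set I := Icc (1 / 2 : ℝ) 2 with hI
  have hsub : I ⊆ Ioi 0 := fun y hy => lt_of_lt_of_le (by norm_num : (0 : ℝ) < 1 / 2) hy.1
  have h1I : (1 : ℝ) ∈ I := by rw [hI]; constructor <;> norm_num
  have hA0 : 0 ≤ A := (abs_nonneg _).trans (hA 1 h1I)
  have hD0 : 0 ≤ D := (integral_nonneg fun _ => abs_nonneg _).trans hD
  have hCw : 0 ≤ Cw := (abs_nonneg _).trans (hWb 0 (Nat.zero_le _) 1 h1I)
  have hvol : ∀ a : ℝ, 0 ≤ a → ∫ _ in I, a ≤ 2 * a := by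
    intro a ha
    rw [setIntegral_const, hI, Real.volume_real_Icc_of_le (by norm_num), smul_eq_mul]
    nlinarith
  set P : ℝ → ℝ := fun r => W r * H r with hP
  have hPsm : ContDiffOn ℝ ((d + 1 : ℕ) : ℕ∞) P (Ioi 0) := hW.contDiffOn.mul hH
  set f₀ : V → ℝ := fun ξ => P ‖ξ‖ with hf₀
  have hz : ∀ ξ : V, ‖ξ‖ ∉ I → f₀ =ᶠ[nhds ξ] fun _ => 0 := by
    intro ξ hξ
    have : {x : V | ‖x‖ ∉ I} ∈ nhds ξ :=
      (isClosed_Icc.preimage continuous_norm).isOpen_compl.mem_nhds hξ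
    filter_upwards [this] with x hx
    simp [hf₀, hP, hsupp _ hx]
  have hmaps : MapsTo (fun x : V => ‖x‖) {0}ᶜ (Ioi 0) := fun x hx => norm_pos_iff.2 hx
  have hsm : ContDiffOn ℝ ((d + 1 : ℕ) : ℕ∞) (fun x : V => ‖x‖) {0}ᶜ := fun x hx =>
    (contDiffAt_norm ℝ hx).contDiffWithinAt
  have hne : ∀ ξ : V, ‖ξ‖ ∈ I → ξ ∈ ({0}ᶜ : Set V) := fun ξ hξ => norm_pos_iff.1 (hsub hξ)
  have hf₀sm : ContDiff ℝ ((d + 1 : ℕ) : ℕ∞) f₀ := by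
    rw [contDiff_iff_contDiffAt]
    intro ξ
    by_cases hξ : ‖ξ‖ ∈ I
    · exact (hPsm.comp hsm hmaps).contDiffAt (isOpen_compl_singleton.mem_nhds (hne ξ hξ))
    · exact contDiffAt_const.congr_of_eventuallyEq (hz ξ hξ)
  -- One majorant for all derivatives of `H` up to order `d + 1`: the orders up to `d` obey the
  -- Landau bound, while the top order is controlled only in the mean and therefore stays as a
  -- function.
  set G : ℝ → ℝ := fun r => c₂ * (A + D) + |iteratedDeriv (d + 1) H r| with hG
  have hbd : ∀ p ≤ d + 1, ∀ ξ : V, ‖iteratedFDeriv ℝ p f₀ ξ‖ ≤ I.indicator (fun r => K * (Cw * G r)) ‖ξ‖ := by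
    intro p hp ξ
    by_cases hξ : ‖ξ‖ ∈ I
    · rw [indicator_of_mem hξ, ← iteratedFDerivWithin_of_isOpen p isOpen_compl_singleton (hne ξ hξ)]
      have hGpos : 0 ≤ G ‖ξ‖ := by positivity
      have h := norm_iteratedFDerivWithin_comp_le (n := p) hPsm hsm (by exact_mod_cast hp)
        isOpen_Ioi.uniqueDiffOn isOpen_compl_singleton.uniqueDiffOn hmaps (hne ξ hξ)
        (C := 2 ^ (d + 1) * (Cw * G ‖ξ‖)) (D := c₃)
        (fun i hi => abs_iteratedDeriv_mul_le (hsub hξ) hCw hW hH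
          (fun k hk => hWb k hk _ hξ) (fun k hk => ?_) (hi.trans hp))
        (fun i hi hi' => (hnorm i (hi'.trans hp) ξ hξ).trans (le_self_pow₀ hc₃ (by omega)))
      · refine h.trans ?_
        have h1 : (p.factorial : ℝ) ≤ (d + 1).factorial := by
          exact_mod_cast Nat.factorial_le hp
        have h2 : c₃ ^ p ≤ c₃ ^ (d + 1) := pow_le_pow_right₀ hc₃ hp
        calc _ ≤ ((d + 1).factorial : ℝ) * (2 ^ (d + 1) * (Cw * G ‖ξ‖)) * c₃ ^ (d + 1) := by gcongr
          _ = _ := by rw [hK]; ring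
      · rcases Nat.lt_or_ge d k with h | h
        · obtain rfl : k = d + 1 := by omega
          have : 0 ≤ c₂ * (A + D) := by positivity
          simp only [hG]
          linarith
        · exact (hland H A D hH hA hD k h _ hξ).trans (by simp [hG])
    · rw [indicator_of_notMem hξ, ((hz ξ hξ).iteratedFDeriv ℝ p).eq_of_nhds]
      rw [iteratedFDeriv_fun_zero]
      simp
  have hGint : IntegrableOn G I := by
    refine ContinuousOn.integrableOn_Icc ?_
    exact continuousOn_const.add
      ((hH.continuousOn_iteratedDeriv_of_isOpen isOpen_Ioi le_rfl).mono hsub).abs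
  have hGI : ∫ r in I, G r ≤ (2 * c₂ + 1) * (A + D) := by
    have hD' : IntegrableOn (fun r => |iteratedDeriv (d + 1) H r|) I :=
      (((hH.continuousOn_iteratedDeriv_of_isOpen isOpen_Ioi le_rfl).mono hsub).abs).integrableOn_Icc
    have hconst : IntegrableOn (fun _ : ℝ => c₂ * (A + D)) I := continuousOn_const.integrableOn_Icc
    simp only [hG]
    rw [integral_add hconst hD']
    have := hvol (c₂ * (A + D)) (by positivity)
    nlinarith
  have hsuppf : HasCompactSupport (fun ξ : V => ((f₀ ξ : ℝ) : ℂ)) := by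
    refine HasCompactSupport.intro (isCompact_closedBall (0 : V) 2) fun ξ hξ => ?_
    have : ‖ξ‖ ∉ I := fun h => hξ (by simpa using h.2)
    simp [(hz ξ this).eq_of_nhds]
  have hfsm : ContDiff ℝ ((d + 1 : ℕ) : ℕ∞) (fun ξ : V => ((f₀ ξ : ℝ) : ℂ)) :=
    Complex.ofRealCLM.contDiff.comp hf₀sm
  have hnormeq : ∀ p ≤ d + 1, ∀ ξ : V,
      ‖iteratedFDeriv ℝ p (fun ξ : V => ((f₀ ξ : ℝ) : ℂ)) ξ‖ = ‖iteratedFDeriv ℝ p f₀ ξ‖ :=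
    fun p hp ξ => Complex.ofRealLI.norm_iteratedFDeriv_comp_left hf₀sm.contDiffAt
      (by exact_mod_cast hp)
  have hint1 := integral_indicator_norm_le V (φ := fun _ => Cw * A)
    continuousOn_const.integrableOn_Icc (fun _ _ => by positivity)
  have hint2 := integral_indicator_norm_le V (φ := fun r => K * (Cw * G r))
    ((hGint.const_mul Cw).const_mul K) (fun r _ => by positivity)
  have hf1 : ∫ ξ : V, ‖((f₀ ξ : ℝ) : ℂ)‖ ≤ c₄ * (2 * (Cw * A)) := by
    refine (integral_mono_of_nonneg (Filter.Eventually.of_forall fun _ => norm_nonneg _) hint1.1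
      (Filter.Eventually.of_forall fun ξ => ?_)).trans (hint1.2.trans ?_)
    · beta_reduce
      by_cases hξ : ‖ξ‖ ∈ I
      · rw [indicator_of_mem hξ]
        simp only [hf₀, hP, Complex.norm_real, norm_mul, Real.norm_eq_abs]
        gcongr
        · simpa using hWb 0 (Nat.zero_le _) _ hξ
        · exact hA _ hξ
      · rw [indicator_of_notMem hξ]
        simp [(hz ξ hξ).eq_of_nhds]
    · gcongr
      exact hvol _ (by positivity)
  have hf2 : ∀ p ≤ d + 1, ∫ ξ : V, ‖iteratedFDeriv ℝ p (fun ξ : V => ((f₀ ξ : ℝ) : ℂ)) ξ‖ ≤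
      c₄ * (K * (Cw * ((2 * c₂ + 1) * (A + D)))) := by
    intro p hp
    refine (integral_mono_of_nonneg (Filter.Eventually.of_forall fun _ => norm_nonneg _) hint2.1
      (Filter.Eventually.of_forall fun ξ => ?_)).trans (hint2.2.trans ?_)
    · exact (hnormeq p hp ξ).trans_le (hbd p hp ξ)
    · rw [integral_const_mul, integral_const_mul]
      gcongr
  refine (hkern _ _ _ R hfsm hsuppf hf1 hf2 hR).mono ?_
  have e1 : 0 ≤ c₁ * c₄ * Cw * (K * (2 * c₂ + 1)) * (R ^ d * A) := by positivity
  have e2 : 0 ≤ c₁ * c₄ * Cw * 2 * ((A + D) / R) := by positivity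
  calc _ = c₁ * c₄ * Cw * 2 * (R ^ d * A) + c₁ * c₄ * Cw * (K * (2 * c₂ + 1)) * ((A + D) / R) := by
        ring
    _ ≤ _ := by
        have : c₁ * (c₄ * (2 + K * (2 * c₂ + 1))) * Cw * (R ^ d * A + (A + D) / R) =
          c₁ * c₄ * Cw * 2 * (R ^ d * A) + c₁ * c₄ * Cw * (K * (2 * c₂ + 1)) * ((A + D) / R) +
          (c₁ * c₄ * Cw * (K * (2 * c₂ + 1)) * (R ^ d * A) +
            c₁ * c₄ * Cw * 2 * ((A + D) / R)) := by ring
        linarith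

end Radial

/-! ### Dyadic pieces of a radial profile -/

section Profiles

/-- Quantitative conditions on a radial profile `E` under which the multiplier `E(|ξ|)` on a space
of dimension `d` and its products with powers of `|ξ|` have integrable kernels. -/
structure RadialProfile (d : ℕ) (D : ℕ → ℝ) (M : ℝ) (E : ℝ → ℝ) : Prop where
  contDiffOn : ContDiffOn ℝ ((d + 1 : ℕ) : ℕ∞) E (Ioi 0)
  zero : E 0 = 1
  nonneg : ∀ r, 0 < r → 0 ≤ E r
  le_one : ∀ r, 0 < r → E r ≤ 1
  one_sub_le : ∀ r, 0 < r → 1 - E r ≤ r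
  pow_mul_le : ∀ (k : ℕ) r, 0 < r → r ^ k * E r ≤ D k
  integrableOn : IntegrableOn (fun r => |iteratedDeriv (d + 1) (fun r => r ^ (d - 1) * E r) r|) (Ioi 0)
  integral_le : ∫ r in Ioi (0 : ℝ), |iteratedDeriv (d + 1) (fun r => r ^ (d - 1) * E r) r| ≤ M

theorem iteratedDeriv_comp_mul_left (k : ℕ) (f : ℝ → ℝ) (c x : ℝ) :
    iteratedDeriv k (fun y => f (c * y)) x = c ^ k * iteratedDeriv k f (c * x) := by
  induction k generalizing x with
  | zero => simp
  | succ k ih =>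
    rw [iteratedDeriv_succ, funext ih, deriv_const_mul_field']
    beta_reduce
    rw [deriv_comp_mul_left, ← iteratedDeriv_succ, smul_eq_mul]
    ring

theorem setIntegral_comp_mul_left_le {φ : ℝ → ℝ} {M l : ℝ} (hφ : IntegrableOn φ (Ioi 0))
    (h0 : ∀ r, 0 ≤ φ r) (hM : ∫ r in Ioi (0 : ℝ), φ r ≤ M) (hl : 0 < l) :
    ∫ r in Icc (1 / 2 : ℝ) 2, φ (l * r) ≤ l⁻¹ * M := by
  have hsub : Icc (1 / 2 : ℝ) 2 ⊆ Ioi 0 := fun y hy =>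
    lt_of_lt_of_le (by norm_num : (0 : ℝ) < 1 / 2) hy.1
  have hint : IntegrableOn (fun r => φ (l * r)) (Ioi 0) := by
    have := (integrableOn_Ioi_comp_mul_left_iff φ 0 hl).2 (by simpa using hφ)
    exact this
  calc _ ≤ ∫ r in Ioi (0 : ℝ), φ (l * r) :=
        setIntegral_mono_set hint (Filter.Eventually.of_forall fun _ => h0 _) hsub.eventuallyLE
    _ = l⁻¹ * ∫ r in Ioi (0 : ℝ), φ r := by
        rw [integral_comp_mul_left_Ioi _ _ hl, mul_zero, smul_eq_mul]
    _ ≤ _ := by gcongr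

variable {V : Type*} [NormedAddCommGroup V] [InnerProductSpace ℝ V] [FiniteDimensional ℝ V]
  [MeasurableSpace V] [BorelSpace V] {d : ℕ} {D : ℕ → ℝ} {M : ℝ}

namespace RadialProfile

variable {E : ℝ → ℝ}

theorem contDiffOn_pow_mul (h : RadialProfile d D M E) :
    ContDiffOn ℝ ((d + 1 : ℕ) : ℕ∞) (fun r => r ^ (d - 1) * E r) (Ioi 0) :=
  (contDiff_id.pow _).contDiffOn.mul h.contDiffOn

theorem contDiffOn_comp_mul_left {f : ℝ → ℝ} {N : ℕ} (hf : ContDiffOn ℝ (N : ℕ∞) f (Ioi 0)) {l : ℝ}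
    (hl : 0 < l) : ContDiffOn ℝ (N : ℕ∞) (fun r => f (l * r)) (Ioi 0) :=
  hf.comp (contDiff_const.mul contDiff_id).contDiffOn fun _ hx => mul_pos hl hx

/-- The chain rule gives `l ^ (d + 1)` and the change of variables gives `l⁻¹`. -/
theorem setIntegral_le (h : RadialProfile d D M E) {l : ℝ} (hl : 0 < l) :
    ∫ r in Icc (1 / 2 : ℝ) 2,
      |iteratedDeriv (d + 1) (fun r => (l * r) ^ (d - 1) * E (l * r)) r| ≤ l ^ d * M := by
  have e : ∀ r, |iteratedDeriv (d + 1) (fun r => (l * r) ^ (d - 1) * E (l * r)) r| =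
      l ^ (d + 1) * |iteratedDeriv (d + 1) (fun r => r ^ (d - 1) * E r) (l * r)| := by
    intro r
    rw [iteratedDeriv_comp_mul_left (d + 1) (fun r => r ^ (d - 1) * E r) l r, abs_mul,
      abs_of_pos (by positivity : 0 < l ^ (d + 1))]
  simp only [e]
  rw [integral_const_mul]
  calc _ ≤ l ^ (d + 1) * (l⁻¹ * M) := by
        gcongr
        exact setIntegral_comp_mul_left_le h.integrableOn (fun _ => abs_nonneg _) h.integral_le hl
    _ = l ^ d * M := by rw [pow_succ]; field_simp

/-- The subtracted term is a polynomial of degree `d - 1`, which `d + 1` derivatives annihilate. -/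
theorem setIntegral_sub_le (h : RadialProfile d D M E) {l : ℝ} (hl : 0 < l) :
    ∫ r in Icc (1 / 2 : ℝ) 2,
      |iteratedDeriv (d + 1) (fun r => (l * r) ^ (d - 1) * (E (l * r) - 1)) r| ≤ l ^ d * M := by
  refine le_trans (le_of_eq ?_) (h.setIntegral_le hl)
  refine setIntegral_congr_fun measurableSet_Icc fun r hr => ?_
  have hr0 : 0 < r := lt_of_lt_of_le (by norm_num : (0 : ℝ) < 1 / 2) hr.1
  have e : (fun r => (l * r) ^ (d - 1) * (E (l * r) - 1)) =
      (fun r => (l * r) ^ (d - 1) * E (l * r)) - fun r => (l * r) ^ (d - 1) := by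
    ext r
    simp only [Pi.sub_apply]
    ring
  have hsm : ContDiffAt ℝ ((d + 1 : ℕ) : ℕ∞) (fun r => (l * r) ^ (d - 1) * E (l * r)) r :=
    (contDiffOn_comp_mul_left h.contDiffOn_pow_mul hl).contDiffAt (Ioi_mem_nhds hr0)
  have hz : iteratedDeriv (d + 1) (fun r => (l * r) ^ (d - 1)) r = 0 := by
    rw [iteratedDeriv_comp_mul_left (d + 1) (fun r => r ^ (d - 1)) l r, iteratedDeriv_pow,
      Nat.descFactorial_eq_zero_iff_lt.2 (by omega)]
    simp
  rw [e, iteratedDeriv_sub hsm (by fun_prop), hz, sub_zero]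

end RadialProfile

variable (D M) in
/-- Decay of the dyadic pieces at high frequencies. -/
theorem exists_hasKernelBound_piece [Nontrivial V] (hd : Module.finrank ℝ V = d) (hM : 0 ≤ M)
    (hD : ∀ k, 0 ≤ D k) (k : ℕ) :
    ∃ c : ℝ, 0 ≤ c ∧ ∀ (E W : ℝ → ℝ) (Cw l : ℝ), RadialProfile d D M E →
      ContDiff ℝ ((d + 1 : ℕ) : ℕ∞) W → (∀ r, r ∉ Icc (1 / 2 : ℝ) 2 → W r = 0) →
      (∀ k ≤ d + 1, ∀ r ∈ Icc (1 / 2 : ℝ) 2, |iteratedDeriv k W r| ≤ Cw) → 0 < l →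
      HasKernelBound (fun ξ : V => ((W ‖ξ‖ * (‖ξ‖ ^ (d - 1) * E (l * ‖ξ‖)) : ℝ) : ℂ))
        (c * Cw * min 1 (l ^ k)⁻¹) := by
  obtain ⟨c, hc, hann⟩ := exists_hasKernelBound_annulus (V := V) hd
  -- With `R = l ^ (k + 1)` below, this exponent is the one for which `R ^ d * (l ^ N)⁻¹ = (l ^
  -- k)⁻¹`.
  set N := (k + 1) * d + k with hN
  refine ⟨c * (2 ^ (d - 1) * (2 ^ N * D N) + (2 * 2 ^ (d - 1) + M)), by
    have := hD N; positivity, ?_⟩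
  intro E W Cw l hE hW hsupp hWb hl
  have hDN := hD N
  have hCw : 0 ≤ Cw := (abs_nonneg _).trans (hWb 0 (Nat.zero_le _) 1 (by norm_num))
  set H : ℝ → ℝ := fun r => (l * r) ^ (d - 1) * E (l * r) with hH
  have hHsm : ContDiffOn ℝ ((d + 1 : ℕ) : ℕ∞) H (Ioi 0) :=
    RadialProfile.contDiffOn_comp_mul_left hE.contDiffOn_pow_mul hl
  have hpos : ∀ r ∈ Icc (1 / 2 : ℝ) 2, 0 < r := fun r hr =>
    lt_of_lt_of_le (by norm_num : (0 : ℝ) < 1 / 2) hr.1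
  have hHabs : ∀ r ∈ Icc (1 / 2 : ℝ) 2, |H r| ≤ (l * 2) ^ (d - 1) * E (l * r) := by
    intro r hr
    have hr0 := hpos r hr
    have hE0 := hE.nonneg (l * r) (by positivity)
    rw [hH, abs_of_nonneg (by positivity)]
    beta_reduce
    gcongr
    exact hr.2
  have hA1 : ∀ r ∈ Icc (1 / 2 : ℝ) 2, |H r| ≤ (l * 2) ^ (d - 1) := by
    intro r hr
    have hr0 := hpos r hr
    refine (hHabs r hr).trans (mul_le_of_le_one_right (by positivity) ?_)
    exact hE.le_one _ (by positivity)
  have hfun : ∀ ξ : V, (((l ^ (d - 1))⁻¹ : ℝ) : ℂ) * ((W ‖ξ‖ * H ‖ξ‖ : ℝ) : ℂ) =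
      ((W ‖ξ‖ * (‖ξ‖ ^ (d - 1) * E (l * ‖ξ‖)) : ℝ) : ℂ) := by
    intro ξ
    rw [← Complex.ofReal_mul]
    congr 1
    simp only [hH, mul_pow]
    field_simp
  have hgen : ∀ A R B : ℝ, (∀ r ∈ Icc (1 / 2 : ℝ) 2, |H r| ≤ A) → 0 < R →
      (l ^ (d - 1))⁻¹ * (R ^ d * A + (A + l ^ d * M) / R) ≤ B →
      HasKernelBound (fun ξ : V => ((W ‖ξ‖ * (‖ξ‖ ^ (d - 1) * E (l * ‖ξ‖)) : ℝ) : ℂ))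
        (c * Cw * B) := by
    intro A R B hA hR hB
    refine (((hann W H Cw A _ R hW hsupp hWb hHsm hA (hE.setIntegral_le hl) hR).const_mul
      (((l ^ (d - 1))⁻¹ : ℝ) : ℂ)).congr hfun).mono ?_
    rw [Complex.norm_real, Real.norm_of_nonneg (by positivity)]
    calc _ = c * Cw * ((l ^ (d - 1))⁻¹ * (R ^ d * A + (A + l ^ d * M) / R)) := by ring
      _ ≤ _ := by gcongr
  have hd1 : 1 ≤ d := hd ▸ Module.finrank_pos
  have hld : l ^ d = l ^ (d - 1) * l := by
    rw [← pow_succ, Nat.sub_add_cancel hd1]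
  have hlp : 0 < l ^ (d - 1) := by positivity
  rcases le_total l 1 with h1 | h1
  · have hmin : min 1 (l ^ k)⁻¹ = 1 :=
      min_eq_left ((one_le_inv₀ (by positivity)).2 (pow_le_one₀ hl.le h1))
    rw [hmin]
    refine (hgen _ 1 (2 * 2 ^ (d - 1) + M) hA1 one_pos ?_).mono ?_
    · rw [hld, mul_pow]
      have : (l ^ (d - 1))⁻¹ * (1 ^ d * (l ^ (d - 1) * 2 ^ (d - 1)) +
          (l ^ (d - 1) * 2 ^ (d - 1) + l ^ (d - 1) * l * M) / 1) = 2 * 2 ^ (d - 1) + l * M := by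
        field_simp
        ring
      rw [this]
      nlinarith
    · have : 0 ≤ c * Cw * (2 ^ (d - 1) * (2 ^ N * D N)) := by positivity
      nlinarith
  · have hmin : min 1 (l ^ k)⁻¹ = (l ^ k)⁻¹ :=
      min_eq_right (inv_le_one_of_one_le₀ (one_le_pow₀ h1))
    rw [hmin]
    -- Both bounds are kept: the rapidly decaying one pays for `R ^ d * A`, while the crude one
    -- suffices for `A / R`.
    have hA2 : ∀ r ∈ Icc (1 / 2 : ℝ) 2, |H r| ≤
        min ((l * 2) ^ (d - 1)) ((l * 2) ^ (d - 1) * (2 ^ N * D N * (l ^ N)⁻¹)) := by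
      intro r hr
      refine le_min (hA1 r hr) ((hHabs r hr).trans ?_)
      have hr0 := hpos r hr
      have hlr : 0 < l * r := by positivity
      gcongr
      rw [← div_eq_mul_inv, le_div_iff₀ (by positivity)]
      calc E (l * r) * l ^ N ≤ E (l * r) * (2 * (l * r)) ^ N := by
            have := hE.nonneg (l * r) hlr
            gcongr
            nlinarith [hr.1]
        _ = 2 ^ N * ((l * r) ^ N * E (l * r)) := by rw [mul_pow]; ring
        _ ≤ _ := by
            gcongr
            exact hE.pow_mul_le N _ hlr
    refine (hgen _ (l ^ (k + 1)) ((2 ^ (d - 1) * (2 ^ N * D N) + (2 ^ (d - 1) + M)) * (l ^ k)⁻¹)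
      hA2 (by positivity) ?_).mono ?_
    · set A := min ((l * 2) ^ (d - 1)) ((l * 2) ^ (d - 1) * (2 ^ N * D N * (l ^ N)⁻¹))
      have a1 : A ≤ (l * 2) ^ (d - 1) := min_le_left _ _
      have a2 : A ≤ (l * 2) ^ (d - 1) * (2 ^ N * D N * (l ^ N)⁻¹) := min_le_right _ _
      have b1 : (l ^ (d - 1))⁻¹ * ((l ^ (k + 1)) ^ d * A) ≤
          2 ^ (d - 1) * (2 ^ N * D N) * (l ^ k)⁻¹ := by
        calc _ ≤ (l ^ (d - 1))⁻¹ * ((l ^ (k + 1)) ^ d *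
              ((l * 2) ^ (d - 1) * (2 ^ N * D N * (l ^ N)⁻¹))) := by gcongr
          _ = _ := by
            have e : l ^ N = (l ^ (k + 1)) ^ d * l ^ k := by rw [hN, pow_add, pow_mul]
            rw [e, mul_pow]
            field_simp
      have b2 : (l ^ (d - 1))⁻¹ * ((A + l ^ d * M) / l ^ (k + 1)) ≤
          (2 ^ (d - 1) + M) * (l ^ k)⁻¹ := by
        calc _ ≤ (l ^ (d - 1))⁻¹ * (((l * 2) ^ (d - 1) * l + l ^ d * M) / l ^ (k + 1)) := by
              gcongr
              exact a1.trans (le_mul_of_one_le_right (by positivity) h1)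
          _ = _ := by
            rw [hld, mul_pow, pow_succ l k]
            field_simp
      rw [mul_add, add_mul]
      exact add_le_add b1 b2
    · have : 0 ≤ c * Cw * 2 ^ (d - 1) * (l ^ k)⁻¹ := by positivity
      nlinarith

variable (D M) in
/-- Smallness of the dyadic pieces of `E - 1` at low frequencies. -/
theorem exists_hasKernelBound_piece_sub_one [Nontrivial V] (hd : Module.finrank ℝ V = d) (hM : 0 ≤ M) :
    ∃ c : ℝ, 0 ≤ c ∧ ∀ (E W : ℝ → ℝ) (Cw l : ℝ), RadialProfile d D M E →
      ContDiff ℝ ((d + 1 : ℕ) : ℕ∞) W → (∀ r, r ∉ Icc (1 / 2 : ℝ) 2 → W r = 0) →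
      (∀ k ≤ d + 1, ∀ r ∈ Icc (1 / 2 : ℝ) 2, |iteratedDeriv k W r| ≤ Cw) → 0 < l →
      HasKernelBound (fun ξ : V => ((W ‖ξ‖ * (‖ξ‖ ^ (d - 1) * (E (l * ‖ξ‖) - 1)) : ℝ) : ℂ))
        (c * Cw * l) := by
  obtain ⟨c, hc, hann⟩ := exists_hasKernelBound_annulus (V := V) hd
  refine ⟨c * (4 * 2 ^ (d - 1) + M), by positivity, ?_⟩
  intro E W Cw l hE hW hsupp hWb hl
  set H : ℝ → ℝ := fun r => (l * r) ^ (d - 1) * (E (l * r) - 1) with hH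
  have hHsm : ContDiffOn ℝ ((d + 1 : ℕ) : ℕ∞) H (Ioi 0) :=
    RadialProfile.contDiffOn_comp_mul_left (f := fun r => r ^ (d - 1) * (E r - 1))
      ((contDiff_id.pow _).contDiffOn.mul (hE.contDiffOn.sub contDiffOn_const)) hl
  have hA : ∀ r ∈ Icc (1 / 2 : ℝ) 2, |H r| ≤ (l * 2) ^ (d - 1) * (l * 2) := by
    intro r hr
    have hr0 : 0 < r := lt_of_lt_of_le (by norm_num : (0 : ℝ) < 1 / 2) hr.1
    have hlr : 0 < l * r := by positivity
    have h1 : |E (l * r) - 1| ≤ l * r := by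
      rw [abs_sub_comm, abs_of_nonneg (by linarith [hE.le_one _ hlr])]
      exact hE.one_sub_le _ hlr
    rw [hH, abs_mul, abs_of_pos (by positivity : 0 < (l * r) ^ (d - 1))]
    have h2 : l * r ≤ l * 2 := by gcongr; exact hr.2
    gcongr
    exact h1.trans h2
  have hd1 : 1 ≤ d := hd ▸ Module.finrank_pos
  have hld : l ^ d = l ^ (d - 1) * l := by
    rw [← pow_succ, Nat.sub_add_cancel hd1]
  have hlp : 0 < l ^ (d - 1) := by positivity
  -- No optimization is needed here: with `R = 1` all terms are of order `l ^ d`, and dividing by `l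
  -- ^ (d - 1)` leaves the factor `l`.
  refine (((hann W H Cw _ _ 1 hW hsupp hWb hHsm hA (hE.setIntegral_sub_le hl) one_pos).const_mul
    (((l ^ (d - 1))⁻¹ : ℝ) : ℂ)).congr fun ξ => ?_).mono (le_of_eq ?_)
  · rw [← Complex.ofReal_mul]
    congr 1
    simp only [hH, mul_pow]
    field_simp
  · rw [Complex.norm_real, Real.norm_of_nonneg (by positivity), hld, mul_pow]
    field_simp
    ring

end Profiles

/-! ### Derivatives depending on a parameter -/

section ParametricDerivatives

/-- Each partial derivative is a directional derivative of a jointly smooth function. Joint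
continuity then gives bounds uniform over compact parameter sets. -/
theorem exists_contDiffOn_iteratedDeriv_snd {Φ : ℝ × ℝ → ℝ} {U : Set (ℝ × ℝ)} (hU : IsOpen U)
    (hΦ : ContDiffOn ℝ (⊤ : ℕ∞) Φ U) (k : ℕ) :
    ∃ Ψ : ℝ × ℝ → ℝ, ContDiffOn ℝ (⊤ : ℕ∞) Ψ U ∧
      ∀ z ∈ U, iteratedDeriv k (fun y => Φ (z.1, y)) z.2 = Ψ z := by
  induction k with
  | zero => exact ⟨Φ, hΦ, fun z _ => by simp⟩
  | succ k ih =>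
    obtain ⟨Ψ, hΨ, h⟩ := ih
    refine ⟨fun z => fderiv ℝ Ψ z (0, 1), ?_, fun z hz => ?_⟩
    · exact (hΨ.fderiv_of_isOpen hU (m := (⊤ : ℕ∞)) le_rfl).clm_apply contDiffOn_const
    · have hd : HasFDerivAt Ψ (fderiv ℝ Ψ z) z :=
        ((hΨ.differentiableOn (by simp)).differentiableAt (hU.mem_nhds hz)).hasFDerivAt
      have hc : HasDerivAt (fun y : ℝ => (z.1, y)) ((0 : ℝ), (1 : ℝ)) z.2 :=
        (hasDerivAt_const _ _).prodMk (hasDerivAt_id _)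
      have hcomp : HasDerivAt (fun y : ℝ => Ψ (z.1, y)) (fderiv ℝ Ψ z (0, 1)) z.2 :=
        HasFDerivAt.comp_hasDerivAt z.2 (f := fun y : ℝ => (z.1, y)) hd hc
      have hev : ∀ᶠ y in nhds z.2, (z.1, y) ∈ U :=
        hc.continuousAt.eventually_mem (hU.mem_nhds hz)
      beta_reduce
      rw [iteratedDeriv_succ, ← hcomp.deriv]
      refine Filter.EventuallyEq.deriv_eq ?_
      filter_upwards [hev] with y hy
      exact h (z.1, y) hy

end ParametricDerivatives

/-! ### Dyadic partition of unity and weighted cutoffs -/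

section Cutoff

/-- A smooth function on `ℝ` which is `1` on `(-∞, 1]` and vanishes on `[2, ∞)`. -/
noncomputable def lowCutoff (r : ℝ) : ℝ := Real.smoothTransition (2 - r)

/-- A smooth function supported in `[1/2, 2]` whose dyadic dilates sum to one. -/
noncomputable def annulusCutoff (r : ℝ) : ℝ := lowCutoff r - lowCutoff (2 * r)

theorem contDiff_lowCutoff {N : ℕ∞} : ContDiff ℝ N lowCutoff :=
  Real.smoothTransition.contDiff.comp (contDiff_const.sub contDiff_id)

theorem contDiff_annulusCutoff {N : ℕ∞} : ContDiff ℝ N annulusCutoff :=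
  contDiff_lowCutoff.sub (contDiff_lowCutoff.comp (contDiff_const.mul contDiff_id))

theorem lowCutoff_of_le {r : ℝ} (h : r ≤ 1) : lowCutoff r = 1 :=
  Real.smoothTransition.one_of_one_le (by linarith)

theorem lowCutoff_of_ge {r : ℝ} (h : 2 ≤ r) : lowCutoff r = 0 :=
  Real.smoothTransition.zero_of_nonpos (by linarith)

theorem annulusCutoff_eq_zero {r : ℝ} (h : r ∉ Icc (1 / 2 : ℝ) 2) : annulusCutoff r = 0 := by
  rw [annulusCutoff]
  rcases lt_or_ge r (1 / 2) with h1 | h1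
  · rw [lowCutoff_of_le (by linarith), lowCutoff_of_le (by linarith), sub_self]
  · have h2 : 2 < r := not_le.1 fun h2 => h ⟨h1, h2⟩
    rw [lowCutoff_of_ge h2.le, lowCutoff_of_ge (by linarith), sub_self]

/-- The sum telescopes, and only finitely many terms are nonzero. -/
theorem hasSum_annulusCutoff_low {r : ℝ} (hr : 0 < r) :
    HasSum (fun j : ℕ => annulusCutoff (2 ^ j * r)) (lowCutoff r) := by
  obtain ⟨N, hN⟩ := pow_unbounded_of_one_lt (2 / r) (one_lt_two : (1 : ℝ) < 2)
  have hbig : ∀ j, N ≤ j → lowCutoff (2 ^ j * r) = 0 := by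
    intro j hj
    refine lowCutoff_of_ge ?_
    rw [div_lt_iff₀ hr] at hN
    have : (2 : ℝ) ^ N ≤ 2 ^ j := pow_le_pow_right₀ one_le_two hj
    nlinarith
  have e : ∀ j : ℕ, annulusCutoff (2 ^ j * r) = lowCutoff (2 ^ j * r) - lowCutoff (2 ^ (j + 1) * r) := by
    intro j
    rw [annulusCutoff, pow_succ']
    ring_nf
  have hsum := hasSum_sum_of_ne_finset_zero (L := .unconditional ℕ) (f := fun j : ℕ => annulusCutoff (2 ^ j * r))
    (s := Finset.range N) (fun j hj => by
      have hj' : N ≤ j := by simpa using hj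
      rw [e, hbig j hj', hbig (j + 1) (by omega), sub_self])
  simp only [e] at hsum
  rw [Finset.sum_range_sub' (fun j => lowCutoff (2 ^ j * r)), hbig N le_rfl] at hsum
  simpa only [e, pow_zero, one_mul, sub_zero] using hsum

theorem hasSum_annulusCutoff_high (r : ℝ) :
    HasSum (fun j : ℕ => annulusCutoff ((2 ^ (j + 1))⁻¹ * r)) (1 - lowCutoff r) := by
  obtain ⟨N, hN⟩ := pow_unbounded_of_one_lt r (one_lt_two : (1 : ℝ) < 2)
  have hbig : ∀ j, N ≤ j → lowCutoff ((2 ^ j)⁻¹ * r) = 1 := by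
    intro j hj
    refine lowCutoff_of_le ?_
    have : (2 : ℝ) ^ N ≤ 2 ^ j := pow_le_pow_right₀ one_le_two hj
    rw [inv_mul_le_iff₀ (by positivity)]
    linarith
  have e : ∀ j : ℕ, annulusCutoff ((2 ^ (j + 1))⁻¹ * r) =
      lowCutoff ((2 ^ (j + 1))⁻¹ * r) - lowCutoff ((2 ^ j)⁻¹ * r) := by
    intro j
    rw [annulusCutoff, pow_succ']
    congr 2
    field_simp
  have hsum := hasSum_sum_of_ne_finset_zero (L := .unconditional ℕ) (f := fun j : ℕ => annulusCutoff ((2 ^ (j + 1))⁻¹ * r))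
    (s := Finset.range N) (fun j hj => by
      have hj' : N ≤ j := by simpa using hj
      rw [e, hbig j hj', hbig (j + 1) (by omega), sub_self])
  simp only [e] at hsum
  rw [Finset.sum_range_sub (fun j => lowCutoff ((2 ^ j)⁻¹ * r)), hbig N le_rfl] at hsum
  simpa only [e, pow_zero, one_mul, inv_one] using hsum

/-- The annulus cutoff with the weight `r ↦ (a² + r²)^{σ/2} / r^m`. -/
noncomputable def weightedCutoff (m : ℕ) (σ a r : ℝ) : ℝ :=
  annulusCutoff r * ((r ^ m)⁻¹ * (a ^ 2 + r ^ 2) ^ (σ / 2))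

variable {m : ℕ} {σ : ℝ}

theorem weightedCutoff_eq_zero {a r : ℝ} (h : r ∉ Icc (1 / 2 : ℝ) 2) :
    weightedCutoff m σ a r = 0 := by
  rw [weightedCutoff, annulusCutoff_eq_zero h, zero_mul]

theorem contDiffOn_weightedCutoff :
    ContDiffOn ℝ (⊤ : ℕ∞) (fun z : ℝ × ℝ => weightedCutoff m σ z.1 z.2) {z | 0 < z.2} := by
  have h1 : ContDiffOn ℝ (⊤ : ℕ∞) (fun z : ℝ × ℝ => annulusCutoff z.2) {z | 0 < z.2} :=
    (contDiff_annulusCutoff.comp contDiff_snd).contDiffOn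
  have h2 : ContDiffOn ℝ (⊤ : ℕ∞) (fun z : ℝ × ℝ => (z.2 ^ m)⁻¹) {z | 0 < z.2} :=
    ContDiffOn.inv (contDiff_snd.pow m).contDiffOn fun z hz => (pow_pos hz m).ne'
  have h3 : ContDiffOn ℝ (⊤ : ℕ∞) (fun z : ℝ × ℝ => (z.1 ^ 2 + z.2 ^ 2) ^ (σ / 2)) {z | 0 < z.2} :=
    ContDiffOn.rpow_const_of_ne ((contDiff_fst.pow 2).add (contDiff_snd.pow 2)).contDiffOn
      fun z hz => (add_pos_of_nonneg_of_pos (sq_nonneg _) (pow_pos hz 2)).ne'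
  exact h1.mul (h2.mul h3)

theorem contDiff_weightedCutoff (a : ℝ) : ContDiff ℝ (⊤ : ℕ∞) (weightedCutoff m σ a) := by
  rw [contDiff_iff_contDiffAt]
  intro r
  rcases lt_or_ge r (1 / 2) with h | h
  · refine (contDiffAt_const (c := (0 : ℝ))).congr_of_eventuallyEq ?_
    filter_upwards [Iio_mem_nhds h] with x hx
    exact weightedCutoff_eq_zero fun hx' => absurd hx'.1 (not_le.2 hx)
  · have hr : 0 < r := by linarith
    have hopen : IsOpen {z : ℝ × ℝ | 0 < z.2} := isOpen_lt continuous_const continuous_snd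
    have h1 : ContDiffAt ℝ (⊤ : ℕ∞) (fun z : ℝ × ℝ => weightedCutoff m σ z.1 z.2) (a, r) :=
      contDiffOn_weightedCutoff.contDiffAt (hopen.mem_nhds hr)
    exact h1.comp r (f := fun r : ℝ => (a, r)) (contDiffAt_const.prodMk contDiffAt_id)

variable (m σ) in
-- Compactness in `(a, r)`: since `r` stays away from `0`, the weight is smooth up to the
-- homogeneous case `a = 0`.
theorem exists_abs_iteratedDeriv_weightedCutoff_le (N : ℕ) : ∃ C : ℝ, 0 ≤ C ∧
    ∀ a ∈ Icc (0 : ℝ) 1, ∀ k ≤ N, ∀ r ∈ Icc (1 / 2 : ℝ) 2,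
      |iteratedDeriv k (weightedCutoff m σ a) r| ≤ C := by
  have hopen : IsOpen {z : ℝ × ℝ | 0 < z.2} := isOpen_lt continuous_const continuous_snd
  have h : ∀ k, ∃ C : ℝ, ∀ a ∈ Icc (0 : ℝ) 1, ∀ r ∈ Icc (1 / 2 : ℝ) 2,
      |iteratedDeriv k (weightedCutoff m σ a) r| ≤ C := by
    intro k
    obtain ⟨Ψ, hΨ, he⟩ := exists_contDiffOn_iteratedDeriv_snd hopen
      (contDiffOn_weightedCutoff (m := m) (σ := σ)) k
    have hsub : Icc (0 : ℝ) 1 ×ˢ Icc (1 / 2 : ℝ) 2 ⊆ {z : ℝ × ℝ | 0 < z.2} := fun z hz =>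
      lt_of_lt_of_le (by norm_num : (0 : ℝ) < 1 / 2) hz.2.1
    obtain ⟨C, hC⟩ := (isCompact_Icc.prod isCompact_Icc).exists_bound_of_continuousOn
      (hΨ.continuousOn.mono hsub)
    refine ⟨C, fun a ha r hr => ?_⟩
    have hz : (a, r) ∈ Icc (0 : ℝ) 1 ×ˢ Icc (1 / 2 : ℝ) 2 := ⟨ha, hr⟩
    have := hC _ hz
    rwa [← he _ (hsub hz)] at this
  choose C hC using h
  refine ⟨∑ k ∈ Finset.range (N + 1), |C k|, Finset.sum_nonneg fun _ _ => abs_nonneg _, ?_⟩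
  intro a ha k hk r hr
  refine (hC k a ha r hr).trans ((le_abs_self _).trans ?_)
  exact Finset.single_le_sum (f := fun k => |C k|) (fun _ _ => abs_nonneg _)
    (Finset.mem_range.2 (by omega))

end Cutoff

/-! ### A two-sided geometric sum -/

section Sums

/-- `∑ⱼ min(qʲ y, (qʲ y)⁻¹)` is bounded uniformly in `y > 0`. -/
theorem exists_tsum_min_le {q : ℝ} (hq : 1 < q) : ∃ S : ℝ, ∀ y : ℝ, 0 < y →
    Summable (fun j : ℕ => min (q ^ j * y) (q ^ j * y)⁻¹) ∧
      ∑' j : ℕ, min (q ^ j * y) (q ^ j * y)⁻¹ ≤ S := by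
  have hq0 : 0 < q := one_pos.trans hq
  have hg : Summable (fun j : ℕ => (q⁻¹) ^ j) :=
    summable_geometric_of_lt_one (by positivity) (inv_lt_one_of_one_lt₀ hq)
  set F : ℤ → ℝ := fun i => q * (q⁻¹) ^ i.natAbs with hF
  have hFs : Summable F := by
    refine Summable.mul_left q ?_
    refine Summable.of_nat_of_neg ?_ ?_ <;> simpa using hg
  have hF0 : ∀ i, 0 ≤ F i := fun i => by positivity
  refine ⟨∑' i, F i, fun y hy => ?_⟩
  -- Once `y` lies between consecutive powers of `q`, the sum is dominated by a shifted part of the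
  -- two-sided series `F`, whose total does not depend on `y`.
  obtain ⟨k, hk1, hk2⟩ := exists_mem_Ico_zpow hy hq
  have hinj : Function.Injective fun j : ℕ => (j : ℤ) + k := fun a b h => by
    simpa using h
  have hle : ∀ j : ℕ, min (q ^ j * y) (q ^ j * y)⁻¹ ≤ F (j + k) := by
    intro j
    have hqj : 0 < q ^ j := by positivity
    have e1 : q ^ j * q ^ k = q ^ ((j : ℤ) + k) := by rw [zpow_add₀ hq0.ne', zpow_natCast]
    rcases le_total 0 ((j : ℤ) + k) with h | h
    · refine (min_le_right _ _).trans ?_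
      have e2 : (q⁻¹) ^ ((j : ℤ) + k).natAbs = (q ^ ((j : ℤ) + k))⁻¹ := by
        rw [inv_pow, ← zpow_natCast, Int.natAbs_of_nonneg h]
      rw [hF]
      beta_reduce
      rw [e2, ← e1]
      calc (q ^ j * y)⁻¹ ≤ (q ^ j * q ^ k)⁻¹ := by gcongr
        _ ≤ _ := le_mul_of_one_le_left (by positivity) hq.le
    · refine (min_le_left _ _).trans ?_
      have e2 : (q⁻¹) ^ ((j : ℤ) + k).natAbs = q ^ ((j : ℤ) + k) := by
        rw [inv_pow, ← zpow_natCast, Int.ofNat_natAbs_of_nonpos h, zpow_neg, inv_inv]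
      rw [hF]
      beta_reduce
      rw [e2, ← e1]
      calc q ^ j * y ≤ q ^ j * q ^ (k + 1) := by gcongr
        _ = _ := by rw [zpow_add_one₀ hq0.ne']; ring
  have hs := hFs.comp_injective hinj
  have hs' : Summable (fun j : ℕ => min (q ^ j * y) (q ^ j * y)⁻¹) :=
    Summable.of_nonneg_of_le (fun j => by positivity) hle hs
  exact ⟨hs', (hs'.tsum_le_tsum hle hs).trans (tsum_comp_le_tsum_of_inj hFs hF0 hinj)⟩

end Sums

/-! ### Summation of the dyadic pieces -/

section Smoothing

variable {V : Type*} [NormedAddCommGroup V] [InnerProductSpace ℝ V] [FiniteDimensional ℝ V]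
  [MeasurableSpace V] [BorelSpace V] {d : ℕ} {D : ℕ → ℝ} {M : ℝ}

variable (V) in
theorem exists_hasKernelBound_lowCutoff (σ : ℝ) : ∃ C : ℝ,
    HasKernelBound (fun ξ : V => ((lowCutoff ‖ξ‖ * (1 + ‖ξ‖ ^ 2) ^ (σ / 2) : ℝ) : ℂ)) C := by
  have h1 : ContDiff ℝ (⊤ : ℕ∞) (fun ξ : V => lowCutoff ‖ξ‖) := by
    rw [contDiff_iff_contDiffAt]
    intro ξ
    by_cases hξ : ξ = 0
    · refine (contDiffAt_const (c := (1 : ℝ))).congr_of_eventuallyEq ?_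
      filter_upwards [(continuous_norm (E := V)).continuousAt.eventually_lt
        (continuousAt_const (y := (1 : ℝ))) (by simp [hξ])] with x hx
      exact lowCutoff_of_le hx.le
    · exact contDiff_lowCutoff.contDiffAt.comp ξ (contDiffAt_norm ℝ hξ)
  have h2 : ContDiff ℝ (⊤ : ℕ∞) (fun ξ : V => (1 + ‖ξ‖ ^ 2) ^ (σ / 2)) :=
    (contDiff_const.add (contDiff_norm_sq ℝ)).rpow_const_of_ne fun ξ => by positivity
  have h3 : ContDiff ℝ (⊤ : ℕ∞)
      (fun ξ : V => ((lowCutoff ‖ξ‖ * (1 + ‖ξ‖ ^ 2) ^ (σ / 2) : ℝ) : ℂ)) :=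
    Complex.ofRealCLM.contDiff.comp (h1.mul h2)
  have h4 : HasCompactSupport
      (fun ξ : V => ((lowCutoff ‖ξ‖ * (1 + ‖ξ‖ ^ 2) ^ (σ / 2) : ℝ) : ℂ)) := by
    refine HasCompactSupport.intro (isCompact_closedBall (0 : V) 2) fun ξ hξ => ?_
    have : 2 ≤ ‖ξ‖ := by
      by_contra hlt
      exact hξ (by simpa using (not_le.1 hlt).le)
    simp [lowCutoff_of_ge this]
  exact HasKernelBound.ofSchwartz (h4.toSchwartzMap h3)

theorem weightedCutoff_mul (m : ℕ) (σ a r x : ℝ) :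
    weightedCutoff m σ a r * (r ^ m * x) = annulusCutoff r * ((a ^ 2 + r ^ 2) ^ (σ / 2) * x) := by
  by_cases hr : r ∈ Icc (1 / 2 : ℝ) 2
  · have : 0 < r := lt_of_lt_of_le (by norm_num : (0 : ℝ) < 1 / 2) hr.1
    rw [weightedCutoff]
    field_simp
  · rw [weightedCutoff_eq_zero hr, annulusCutoff_eq_zero hr, zero_mul, zero_mul]

variable (V D M) in
/-- Uniform kernel bound for the multipliers `E(|ξ|)`. -/
theorem exists_hasKernelBound_profile [Nontrivial V] (hd : Module.finrank ℝ V = d) (hM : 0 ≤ M)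
    (hD : ∀ k, 0 ≤ D k) : ∃ C : ℝ, ∀ E : ℝ → ℝ, RadialProfile d D M E →
      HasKernelBound (fun ξ : V => ((E ‖ξ‖ : ℝ) : ℂ)) C := by
  obtain ⟨C₀, h₀⟩ := exists_hasKernelBound_lowCutoff V 0
  obtain ⟨Cw, hCw, hW⟩ := exists_abs_iteratedDeriv_weightedCutoff_le (d - 1) 0 (d + 1)
  obtain ⟨c₁, hc₁, h₁⟩ := exists_hasKernelBound_piece (V := V) D M hd hM hD 1
  obtain ⟨c₂, hc₂, h₂⟩ := exists_hasKernelBound_piece_sub_one (V := V) D M hd hM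
  refine ⟨C₀ + c₂ * Cw * 2 + c₁ * Cw * 2, fun E hE => ?_⟩
  have hWsm : ContDiff ℝ ((d + 1 : ℕ) : ℕ∞) (weightedCutoff (d - 1) 0 0) :=
    (contDiff_weightedCutoff 0).of_le (by exact_mod_cast le_top)
  have hWb := hW 0 (by norm_num)
  -- The splitting is `E = χ + χ (E - 1) + (1 - χ) E` with `χ` the low cutoff. With `σ = a = 0` the
  -- weight in the cutoff is `r ^ (-(d - 1))`, which cancels the power of `r` in the piece
  -- estimates.
  have hlow : ∀ j : ℕ, HasKernelBound
      (fun ξ : V => ((annulusCutoff (2 ^ j * ‖ξ‖) * (E ‖ξ‖ - 1) : ℝ) : ℂ))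
      (c₂ * Cw * (1 / 2) ^ j) := by
    intro j
    have h2 : (0 : ℝ) < 2 ^ j := by positivity
    refine (((h₂ E _ Cw (2 ^ j)⁻¹ hE hWsm (fun r hr => weightedCutoff_eq_zero hr) hWb
      (by positivity)).comp_smul h2).congr fun ξ => ?_).mono (by simp)
    rw [weightedCutoff_mul, norm_smul, Real.norm_of_nonneg h2.le, inv_mul_cancel_left₀ h2.ne']
    simp
  have hhigh : ∀ j : ℕ, HasKernelBound
      (fun ξ : V => ((annulusCutoff ((2 ^ (j + 1))⁻¹ * ‖ξ‖) * E ‖ξ‖ : ℝ) : ℂ))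
      (c₁ * Cw * (1 / 2) ^ j) := by
    intro j
    have h2 : (0 : ℝ) < 2 ^ (j + 1) := by positivity
    refine (((h₁ E _ Cw (2 ^ (j + 1)) hE hWsm (fun r hr => weightedCutoff_eq_zero hr) hWb
      (by positivity)).comp_smul (inv_pos.2 h2)).congr fun ξ => ?_).mono ?_
    · rw [weightedCutoff_mul, norm_smul, Real.norm_of_nonneg (inv_pos.2 h2).le,
        mul_inv_cancel_left₀ h2.ne']
      simp
    · gcongr
      refine (min_le_right _ _).trans ?_
      rw [pow_one, one_div, inv_pow]
      gcongr <;> norm_num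
  have hlows := HasKernelBound.hasSum hlow (hasSum_geometric_two.mul_left (c₂ * Cw))
    (M := fun ξ : V => ((lowCutoff ‖ξ‖ * (E ‖ξ‖ - 1) : ℝ) : ℂ)) (fun ξ => by
      rw [Complex.hasSum_ofReal]
      by_cases hξ : ξ = 0
      -- The annuli do not cover the origin, but `E 0 = 1` makes the symbol vanish there.
      · simp [hξ, hE.zero, hasSum_zero]
      · exact (hasSum_annulusCutoff_low (norm_pos_iff.2 hξ)).mul_right _)
  have hhighs := HasKernelBound.hasSum hhigh (hasSum_geometric_two.mul_left (c₁ * Cw))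
    (M := fun ξ : V => (((1 - lowCutoff ‖ξ‖) * E ‖ξ‖ : ℝ) : ℂ)) (fun ξ => by
      rw [Complex.hasSum_ofReal]
      exact (hasSum_annulusCutoff_high ‖ξ‖).mul_right _)
  refine ((h₀.add hlows).add hhighs).congr fun ξ => ?_
  push_cast
  simp
  ring

variable (V D M) in
/-- Kernel bound for the multipliers `(1 + |ξ|²)^{σ/2} E(y|ξ|)`. -/
theorem exists_hasKernelBound_smoothing [Nontrivial V] (hd : Module.finrank ℝ V = d) (hM : 0 ≤ M)
    (hD : ∀ k, 0 ≤ D k) {σ : ℝ} (hσ : 0 ≤ σ) {y₀ : ℝ} (hy₀ : 0 < y₀) :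
    ∃ C : ℝ, 0 ≤ C ∧ ∀ (E : ℝ → ℝ) (y : ℝ), RadialProfile d D M E → y ∈ Ioc 0 y₀ →
      HasKernelBound (fun ξ : V => (((1 + ‖ξ‖ ^ 2) ^ (σ / 2) * E (y * ‖ξ‖) : ℝ) : ℂ))
        (C * y ^ (-σ)) := by
  obtain ⟨Cb, hb⟩ := exists_hasKernelBound_profile V D M hd hM hD
  rcases hσ.eq_or_lt with rfl | hσ
  · refine ⟨|Cb|, abs_nonneg _, fun E y hE hy => (((hb E hE).comp_smul hy.1).congr fun ξ => ?_).mono ?_⟩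
    · simp [norm_smul, abs_of_pos hy.1]
    · simpa using le_abs_self Cb
  obtain ⟨C₀, h₀⟩ := exists_hasKernelBound_lowCutoff V σ
  obtain ⟨Cw, hCw, hW⟩ := exists_abs_iteratedDeriv_weightedCutoff_le (d - 1) σ (d + 1)
  -- Decay of order `2σ` beats the growth `l ^ σ` of the weight and leaves a surplus of order `σ`.
  -- The summation ratio `2 ^ σ` exceeds `1` only for `σ > 0`, hence the separate case above.
  obtain ⟨k, hk⟩ := exists_nat_ge (2 * σ)
  obtain ⟨c, hc, hp⟩ := exists_hasKernelBound_piece (V := V) D M hd hM hD k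
  obtain ⟨S, hS⟩ := exists_tsum_min_le (q := 2 ^ σ) (Real.one_lt_rpow one_lt_two hσ)
  refine ⟨|C₀ * Cb| * y₀ ^ σ + c * Cw * |S|, by positivity, fun E y hE hy => ?_⟩
  have hy0 := hy.1
  have hbase : HasKernelBound (fun ξ : V => ((E (y * ‖ξ‖) : ℝ) : ℂ)) Cb :=
    ((hb E hE).comp_smul hy0).congr fun ξ => by rw [norm_smul, Real.norm_of_nonneg hy0.le]
  have hpiece : ∀ j : ℕ, HasKernelBound
      (fun ξ : V => ((annulusCutoff ((2 ^ (j + 1))⁻¹ * ‖ξ‖) *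
        ((1 + ‖ξ‖ ^ 2) ^ (σ / 2) * E (y * ‖ξ‖)) : ℝ) : ℂ))
      (c * Cw * y ^ (-σ) * min ((2 ^ σ) ^ j * (2 * y) ^ σ) ((2 ^ σ) ^ j * (2 * y) ^ σ)⁻¹) := by
    intro j
    set l : ℝ := 2 ^ (j + 1) with hl
    have hl0 : 0 < l := by positivity
    have hl1 : l⁻¹ ≤ 1 := inv_le_one_of_one_le₀ (one_le_pow₀ one_le_two)
    -- Pulling `l ^ σ` out of the weight at frequency scale `l` leaves the parameter `a = l⁻¹`,
    -- which lies in `[0, 1]`.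
    have hpj := (hp E (weightedCutoff (d - 1) σ l⁻¹) Cw (y * l) hE
      ((contDiff_weightedCutoff _).of_le (by exact_mod_cast le_top))
      (fun r hr => weightedCutoff_eq_zero hr) (hW _ ⟨by positivity, hl1⟩) (by positivity))
    refine (((hpj.comp_smul (inv_pos.2 hl0)).const_mul ((l ^ σ : ℝ) : ℂ)).congr fun ξ => ?_).mono ?_
    · rw [weightedCutoff_mul, ← Complex.ofReal_mul, norm_smul,
        Real.norm_of_nonneg (inv_pos.2 hl0).le, mul_assoc y, mul_inv_cancel_left₀ hl0.ne']
      have e : (1 + ‖ξ‖ ^ 2) ^ (σ / 2) = l ^ σ * (l⁻¹ ^ 2 + (l⁻¹ * ‖ξ‖) ^ 2) ^ (σ / 2) := by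
        have e1 : l ^ σ = (l ^ 2) ^ (σ / 2) := by
          rw [← Real.rpow_natCast l 2, ← Real.rpow_mul hl0.le]
          congr 1
          push_cast
          ring
        rw [e1, ← Real.mul_rpow (by positivity) (by positivity)]
        congr 1
        field_simp
      rw [e]
      congr 1
      ring
    · set z := (y * l) ^ σ with hz
      have hyl : 0 < y * l := by positivity
      have hz0 : 0 < z := by positivity
      have ez : (2 ^ σ) ^ j * (2 * y) ^ σ = z := by
        rw [hz, ← Real.rpow_natCast (2 ^ σ) j, ← Real.rpow_mul (by norm_num : (0 : ℝ) ≤ 2), mul_comm σ,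
          Real.rpow_mul (by norm_num : (0 : ℝ) ≤ 2), ← Real.mul_rpow (by positivity) (by positivity),
          Real.rpow_natCast, hl, pow_succ]
        congr 1
        ring
      have el : l ^ σ = y ^ (-σ) * z := by
        rw [hz, Real.mul_rpow hy0.le hl0.le, ← mul_assoc, ← Real.rpow_add hy0]
        simp
      rw [ez, Complex.norm_real, Real.norm_of_nonneg (by positivity), el]
      have key : z * min 1 ((y * l) ^ k)⁻¹ ≤ min z z⁻¹ := by
        refine le_min (mul_le_of_le_one_right hz0.le (min_le_left _ _)) ?_
        rcases le_total (y * l) 1 with h1 | h1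
        · have : z ≤ 1 := Real.rpow_le_one hyl.le h1 hσ.le
          calc z * min 1 ((y * l) ^ k)⁻¹ ≤ z * 1 := by gcongr; exact min_le_left _ _
            _ ≤ 1 := by linarith
            _ ≤ z⁻¹ := (one_le_inv₀ hz0).2 this
        · have hzk : z * z ≤ (y * l) ^ k := by
            rw [hz, ← Real.rpow_add hyl, ← Real.rpow_natCast]
            exact Real.rpow_le_rpow_of_exponent_le h1 (by linarith)
          calc z * min 1 ((y * l) ^ k)⁻¹ ≤ z * (z * z)⁻¹ := by
                gcongr
                exact (min_le_right _ _).trans (by gcongr)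
            _ = z⁻¹ := by field_simp
      calc _ = c * Cw * y ^ (-σ) * (z * min 1 ((y * l) ^ k)⁻¹) := by ring
        _ ≤ _ := by gcongr
  obtain ⟨hs1, hs2⟩ := hS ((2 * y) ^ σ) (by positivity)
  have hsum := HasKernelBound.hasSum hpiece (hs1.hasSum.mul_left (c * Cw * y ^ (-σ)))
    (M := fun ξ : V => (((1 - lowCutoff ‖ξ‖) * ((1 + ‖ξ‖ ^ 2) ^ (σ / 2) * E (y * ‖ξ‖)) : ℝ) : ℂ))
    (fun ξ => by
      rw [Complex.hasSum_ofReal]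
      exact (hasSum_annulusCutoff_high ‖ξ‖).mul_right _)
  refine (((h₀.mul hbase).add hsum).congr fun ξ => ?_).mono ?_
  · push_cast
    ring
  -- The low-frequency part is merely bounded; `y ≤ y₀` lets `y ^ (-σ)` absorb it.
  · have hyσ : 1 ≤ y₀ ^ σ * y ^ (-σ) := by
      rw [Real.rpow_neg hy0.le, ← div_eq_mul_inv, one_le_div (by positivity)]
      exact Real.rpow_le_rpow hy0.le hy.2 hσ.le
    have h1 : C₀ * Cb ≤ |C₀ * Cb| * (y₀ ^ σ * y ^ (-σ)) :=
      (le_abs_self _).trans (le_mul_of_one_le_right (abs_nonneg _) hyσ)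
    have h2 : c * Cw * y ^ (-σ) * ∑' j : ℕ, min ((2 ^ σ) ^ j * (2 * y) ^ σ)
        ((2 ^ σ) ^ j * (2 * y) ^ σ)⁻¹ ≤ c * Cw * y ^ (-σ) * |S| := by
      gcongr
      exact hs2.trans (le_abs_self _)
    calc _ ≤ |C₀ * Cb| * (y₀ ^ σ * y ^ (-σ)) + c * Cw * y ^ (-σ) * |S| := add_le_add h1 h2
      _ = _ := by ring

end Smoothing

/-! ### Fourier transform and duality pairings -/

section FourierPairing

variable {V : Type*} [NormedAddCommGroup V] [InnerProductSpace ℝ V] [FiniteDimensional ℝ V]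
  [MeasurableSpace V] [BorelSpace V]

theorem integral_fourier_mul_eq_of_integrable {f g : V → ℂ} (hf : Integrable f) (hg : Integrable g) :
    ∫ ξ, 𝓕 f ξ * g ξ = ∫ x, f x * 𝓕 g x := by
  have h := VectorFourier.integral_fourierIntegral_smul_eq_flip (L := innerₗ V)
    Real.continuous_fourierChar (by simpa using continuous_inner) hf hg
  simp only [smul_eq_mul, flip_innerₗ] at h
  exact h

theorem integral_mul_fourierInv_eq {f g : V → ℂ} (hf : Integrable f) (hg : Integrable g) :
    ∫ x, g x * 𝓕⁻ f x = ∫ ξ, f ξ * 𝓕⁻ g ξ := by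
  have h := integral_fourier_mul_eq_of_integrable hf.comp_neg hg
  rw [← Real.fourierInv_eq_fourier_comp_neg] at h
  simp only [mul_comm (g _)]
  rw [h, ← integral_neg_eq_self (fun x => f x * 𝓕⁻ g x)]
  simp [Real.fourierInv_eq_fourier_neg]

theorem norm_fourierInv_comp_sub (f : V → ℂ) (a x : V) :
    ‖𝓕⁻ (fun ξ => f (ξ - a)) x‖ = ‖𝓕⁻ f x‖ := by
  have h := integral_sub_right_eq_self
    (fun v => Real.fourierChar (inner ℝ (v + a) x) • f v) a (μ := volume)
  simp only [sub_add_cancel] at h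
  have e : ∀ v, Real.fourierChar (inner ℝ (v + a) x) • f v =
      (Real.fourierChar (inner ℝ a x) : ℂ) * (Real.fourierChar (inner ℝ v x) • f v) := by
    intro v
    rw [inner_add_left, AddChar.map_add_eq_mul, mul_comm, mul_smul, Circle.smul_def, smul_eq_mul]
  simp only [e] at h
  rw [Real.fourierInv_eq, h, integral_const_mul, norm_mul, Circle.norm_coe, one_mul,
    Real.fourierInv_eq]

end FourierPairing

/-! ### Boundedness of a monotone `L^p` multiplier symbol -/

section BoundedSymbols

theorem measurable_comp_norm_of_monotoneOn {V : Type*} [NormedAddCommGroup V] [MeasurableSpace V]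
    [BorelSpace V] {g : ℝ → ℝ} (hg : MonotoneOn g (Ici 0)) :
    Measurable (fun x : V => g ‖x‖) := by
  have h : Monotone (fun r => g (max r 0)) := fun a b hab =>
    hg (show 0 ≤ max a 0 from le_max_right _ _) (show 0 ≤ max b 0 from le_max_right _ _)
      (max_le_max_right _ hab)
  have := h.measurable.comp (measurable_norm (α := V))
  simpa [Function.comp_def] using this

/-- Hölder's inequality with the conjugate exponent written as `(1 - p⁻¹)⁻¹`. -/
theorem norm_integral_mul_le_of_ae_eq {α : Type*} [MeasurableSpace α] {μ : Measure α}
    {p : ℝ≥0∞} [Fact (1 ≤ p)] (u : Lp ℂ p μ) {v φ : α → ℂ} (hae : u =ᵐ[μ] v)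
    (hφ : MemLp φ (1 - p⁻¹)⁻¹ μ) :
    ‖∫ x, φ x * v x ∂μ‖ ≤ (eLpNorm φ (1 - p⁻¹)⁻¹ μ).toReal * ‖u‖ := by
  have hp : 1 ≤ p := Fact.out
  have hHT : ENNReal.HolderTriple (1 - p⁻¹)⁻¹ p 1 :=
    (ENNReal.HolderConjugate.inv_one_sub_inv' hp).symm
  have e1 : ∫ x, φ x * v x ∂μ = ∫ x, (φ • ⇑u) x ∂μ := by
    refine integral_congr_ae ?_
    filter_upwards [hae] with x hx
    simp [hx]
  have hutop : eLpNorm u p μ ≠ ∞ := Lp.eLpNorm_ne_top _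
  have h1 : eLpNorm (φ • ⇑u) 1 μ ≤ eLpNorm φ (1 - p⁻¹)⁻¹ μ * eLpNorm u p μ :=
    eLpNorm_smul_le_mul_eLpNorm (Lp.aestronglyMeasurable _) hφ.1
  have h2 : ‖∫ x, (φ • ⇑u) x ∂μ‖ ≤ (eLpNorm (φ • ⇑u) 1 μ).toReal := by
    rw [eLpNorm_one_eq_lintegral_enorm] at h1 ⊢
    rw [← toReal_enorm]
    exact ENNReal.toReal_mono
      (ne_top_of_le_ne_top (ENNReal.mul_ne_top hφ.eLpNorm_ne_top hutop) h1)
      (enorm_integral_le_lintegral_enorm _)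
  rw [e1, Lp.norm_def, ← ENNReal.toReal_mul]
  exact h2.trans (ENNReal.toReal_mono (ENNReal.mul_ne_top hφ.eLpNorm_ne_top hutop) h1)


theorem exists_norm_toLp_le {n : ℕ} {p : ℝ≥0∞} [Fact (1 ≤ p)]
    (G : Lp ℂ p (volume : Measure (EuclideanSpace ℝ (Fin n))) →L[ℂ]
      Lp ℂ p (volume : Measure (EuclideanSpace ℝ (Fin n)))) :
    ∃ A : ℝ, 0 ≤ A ∧ ∀ f : 𝓢(EuclideanSpace ℝ (Fin n), ℂ),
      ‖G (f.toLp p)‖ ≤ A * (eLpNorm f p volume).toReal := by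
  obtain ⟨A, hA0, hA⟩ := G.bound
  refine ⟨A, hA0.le, fun f => ?_⟩
  have := hA (f.toLp p)
  rwa [SchwartzMap.norm_toLp] at this

/-- A monotone radial symbol that is bounded on `L^p` is bounded. -/
theorem MultiplierBoundedOnLp.exists_le {n : ℕ} (hn : 1 ≤ n) {p : ℝ≥0∞} [Fact (1 ≤ p)] {g : ℝ → ℝ}
    (hg_mono : MonotoneOn g (Ici 0)) (hg_nonneg : ∀ r, 0 ≤ r → 0 ≤ g r)
    (hG : MultiplierBoundedOnLp p (fun ξ : EuclideanSpace ℝ (Fin n) => (g ‖ξ‖ : ℂ))) :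
    ∃ B : ℝ, ∀ r, 0 ≤ r → g r ≤ B := by
  obtain ⟨G, hG⟩ := hG
  obtain ⟨A, hA0, hA⟩ := exists_norm_toLp_le G
  have : Nonempty (Fin n) := ⟨⟨0, hn⟩⟩
  let ψ : ContDiffBump (0 : EuclideanSpace ℝ (Fin n)) := ⟨1 / 2, 1, by norm_num, by norm_num⟩
  have hsm : ContDiff ℝ (⊤ : ℕ∞) (fun ξ => ((ψ ξ : ℝ) : ℂ)) := Complex.ofRealCLM.contDiff.comp ψ.contDiff
  have hcs : HasCompactSupport (fun ξ => ((ψ ξ : ℝ) : ℂ)) :=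
    ψ.hasCompactSupport.comp_left (g := fun x : ℝ => (x : ℂ)) (by simp)
  have hsma : ∀ a, ContDiff ℝ (⊤ : ℕ∞) (fun ξ => ((ψ (ξ - a) : ℝ) : ℂ)) := fun a =>
    hsm.comp (contDiff_id.sub contDiff_const)
  have hcsa : ∀ a, HasCompactSupport (fun ξ => ((ψ (ξ - a) : ℝ) : ℂ)) := fun a =>
    hcs.comp_homeomorph (Homeomorph.subRight a)
  set Ψ : EuclideanSpace ℝ (Fin n) → 𝓢(EuclideanSpace ℝ (Fin n), ℂ) := fun a =>
    (hcsa a).toSchwartzMap (hsma a) with hΨ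
  have hΨa : ∀ a ξ, Ψ a ξ = ((ψ (ξ - a) : ℝ) : ℂ) := fun a ξ => rfl
  set p' : ℝ≥0∞ := (1 - p⁻¹)⁻¹ with hp'
  set F : EuclideanSpace ℝ (Fin n) → 𝓢(EuclideanSpace ℝ (Fin n), ℂ) := fun a => 𝓕⁻ (Ψ a) with hF
  set Φ : EuclideanSpace ℝ (Fin n) → 𝓢(EuclideanSpace ℝ (Fin n), ℂ) := fun a => 𝓕 (Ψ a) with hΦ
  have hFnorm : ∀ a x, ‖F a x‖ = ‖𝓕⁻ (fun ξ => ((ψ ξ : ℝ) : ℂ)) x‖ := by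
    intro a x
    rw [hF, SchwartzMap.fourierInv_coe]
    exact norm_fourierInv_comp_sub (fun ξ => ((ψ ξ : ℝ) : ℂ)) a x
  have hΦnorm : ∀ a x, ‖Φ a x‖ = ‖𝓕⁻ (fun ξ => ((ψ ξ : ℝ) : ℂ)) (-x)‖ := by
    intro a x
    rw [hΦ, SchwartzMap.fourier_coe, ← neg_neg x, ← Real.fourierInv_eq_fourier_neg, neg_neg]
    exact norm_fourierInv_comp_sub (fun ξ => ((ψ ξ : ℝ) : ℂ)) a (-x)
  have hFF : ∀ a, 𝓕 (F a) = Ψ a := fun a => FourierTransform.fourier_fourierInv_eq _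
  have hmeas : Measurable (fun ξ : EuclideanSpace ℝ (Fin n) => g ‖(2 * Real.pi) • ξ‖) :=
    (measurable_comp_norm_of_monotoneOn hg_mono).comp (measurable_const_smul _)
  have hsym : ∀ a ξ, symbolMul (fun ξ : EuclideanSpace ℝ (Fin n) => (g ‖ξ‖ : ℂ)) (F a) ξ
      = ((g ‖(2 * Real.pi) • ξ‖ * ψ (ξ - a) : ℝ) : ℂ) := by
    intro a ξ
    rw [symbolMul, hFF, hΨa, Complex.ofReal_mul]
  have hψsupp : ∀ ξ, ψ ξ ≠ 0 → ‖ξ‖ < 1 := by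
    intro ξ hξ
    have : ξ ∈ Function.support ψ := hξ
    rw [ψ.support_eq] at this
    simpa using this
  have hint : ∀ a, Integrable (symbolMul (fun ξ : EuclideanSpace ℝ (Fin n) => (g ‖ξ‖ : ℂ)) (F a)) := by
    intro a
    have hΨint : Integrable (fun ξ => ((ψ (ξ - a) : ℝ) : ℂ)) := (Ψ a).integrable
    refine (hΨint.norm.const_mul (g (2 * Real.pi * (‖a‖ + 1)))).mono' ?_
      (Filter.Eventually.of_forall fun ξ => ?_)
    · simp only [funext (hsym a)]
      exact (Complex.measurable_ofReal.comp (hmeas.mul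
        (ψ.continuous.measurable.comp (measurable_sub_const a)))).aestronglyMeasurable
    · rw [hsym, Complex.norm_real, Complex.norm_real, norm_mul]
      by_cases h0 : ψ (ξ - a) = 0
      · simp [h0]
      · have hξ : ‖ξ‖ ≤ ‖a‖ + 1 := by
          have := norm_add_le (ξ - a) a
          rw [sub_add_cancel] at this
          linarith [hψsupp _ h0]
        gcongr
        rw [Real.norm_of_nonneg (hg_nonneg _ (norm_nonneg _))]
        refine hg_mono (norm_nonneg _) (by simp only [mem_Ici]; positivity) ?_
        rw [norm_smul, Real.norm_of_nonneg (by positivity)]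
        gcongr
  set P : ℝ≥0∞ := eLpNorm (𝓕⁻ (fun ξ => ((ψ ξ : ℝ) : ℂ))) p volume with hP
  set P' : ℝ≥0∞ := eLpNorm (fun x => 𝓕⁻ (fun ξ => ((ψ ξ : ℝ) : ℂ)) (-x)) p' volume with hP'
  have hPF : ∀ a, eLpNorm (F a) p volume = P := fun a =>
    eLpNorm_congr_norm_ae (Filter.Eventually.of_forall fun x => hFnorm a x)
  have hPΦ : ∀ a, eLpNorm (Φ a) p' volume = P' := fun a =>
    eLpNorm_congr_norm_ae (Filter.Eventually.of_forall fun x => hΦnorm a x)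
  set J : ℝ := ∫ ξ, ψ ξ ^ 2 with hJ
  have hψ2 : Continuous (fun ξ => ψ ξ ^ 2) := ψ.continuous.pow 2
  have hψ2s : HasCompactSupport (fun ξ => ψ ξ ^ 2) :=
    ψ.hasCompactSupport.comp_left (g := fun x : ℝ => x ^ 2) (by simp)
  have hJpos : 0 < J := by
    refine hψ2.integral_pos_of_hasCompactSupport_nonneg_nonzero hψ2s (fun ξ => sq_nonneg _) (x := 0) ?_
    have : ψ 0 = 1 := ψ.one_of_mem_closedBall (by simp [ψ])
    simp [this]
  -- This bound does not depend on `a`, as translating the bump in frequency only modulates `F a`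
  -- and `Φ a`.
  have hupper : ∀ a, ‖∫ x, Φ a x * multiplierApply (fun ξ : EuclideanSpace ℝ (Fin n) => (g ‖ξ‖ : ℂ)) (F a) x‖
      ≤ P'.toReal * (A * P.toReal) := by
    intro a
    have h := norm_integral_mul_le_of_ae_eq _ (hG (F a) (hint a)) ((Φ a).memLp _)
    rw [hPΦ] at h
    refine h.trans ?_
    gcongr
    rw [← hPF a]
    exact hA _
  refine ⟨P'.toReal * (A * P.toReal) / J, fun r hr => ?_⟩
  rw [le_div_iff₀ hJpos]
  -- The bump lives in the unit ball about `a`, so `|ξ| ≥ r` on its support. There `g(2π|ξ|) ≥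
  -- g(r)`, and the pairing is at least `g r * J`.
  obtain ⟨a, ha⟩ := exists_norm_eq (EuclideanSpace ℝ (Fin n)) (c := r + 1) (by positivity)
  refine le_trans ?_ (hupper a)
  have hinv : ∀ ξ, 𝓕⁻ (⇑(Φ a)) ξ = Ψ a ξ := by
    intro ξ
    rw [← SchwartzMap.fourierInv_coe, hΦ]
    rw [FourierTransform.fourierInv_fourier_eq]
  have e2 : ∫ x, Φ a x * multiplierApply (fun ξ : EuclideanSpace ℝ (Fin n) => (g ‖ξ‖ : ℂ)) (F a) x
      = ((∫ ξ, g ‖(2 * Real.pi) • ξ‖ * ψ (ξ - a) ^ 2 : ℝ) : ℂ) := by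
    rw [multiplierApply, integral_mul_fourierInv_eq (hint a) (Φ a).integrable, ← integral_complex_ofReal]
    congr 1
    ext ξ
    rw [hsym, hinv, hΨa]
    push_cast
    ring
  rw [e2, Complex.norm_real]
  refine le_trans ?_ (le_abs_self _)
  have e3 : J = ∫ ξ, ψ (ξ - a) ^ 2 := (integral_sub_right_eq_self (fun ξ => ψ ξ ^ 2) a).symm
  rw [e3, ← integral_const_mul]
  refine integral_mono_of_nonneg (Filter.Eventually.of_forall fun ξ => ?_) ?_
    (Filter.Eventually.of_forall fun ξ => ?_)
  · exact mul_nonneg (hg_nonneg _ hr) (sq_nonneg _)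
  · have hi := (hint a).re
    refine (hi.mono' ?_ (Filter.Eventually.of_forall fun ξ => ?_))
    · exact (hmeas.mul ((ψ.continuous.measurable.comp (measurable_sub_const a)).pow_const 2)).aestronglyMeasurable
    · rw [hsym]
      have h0 := hg_nonneg ‖(2 * Real.pi) • ξ‖ (norm_nonneg _)
      have h1 := ψ.le_one (x := ξ - a)
      have h2 := ψ.nonneg' (ξ - a)
      rw [Real.norm_of_nonneg (by positivity)]
      simp only [RCLike.re_to_complex, Complex.ofReal_re]
      gcongr
      nlinarith
  · by_cases h0 : ψ (ξ - a) = 0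
    · simp [h0]
    · have hξ : r ≤ ‖(2 * Real.pi) • ξ‖ := by
        have h1 := norm_sub_norm_le a ξ
        rw [norm_sub_rev a ξ] at h1
        have h2 := hψsupp _ h0
        rw [norm_smul, Real.norm_of_nonneg (by positivity)]
        have h3 : r ≤ ‖ξ‖ := by linarith
        have := Real.pi_gt_three
        nlinarith [norm_nonneg ξ]
      have := hg_mono hr (norm_nonneg ((2 * Real.pi) • ξ)) hξ
      exact mul_le_mul_of_nonneg_right this (sq_nonneg _)

end BoundedSymbols

/-! ### Convolution operators on `L^p` -/

section ConvolutionOperator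

variable {V : Type*} [NormedAddCommGroup V] [InnerProductSpace ℝ V] [FiniteDimensional ℝ V]
  [MeasurableSpace V] [BorelSpace V] {p : ℝ≥0∞} [Fact (1 ≤ p)]

/-- Translation of `L^p` functions. -/
noncomputable def translateLp (p : ℝ≥0∞) [Fact (1 ≤ p)] (y : V) :
    Lp ℂ p (volume : Measure V) →ₗᵢ[ℂ] Lp ℂ p (volume : Measure V) :=
  Lp.compMeasurePreservingₗᵢ ℂ (fun x => x - y) (measurePreserving_sub_right volume y)

theorem continuous_translateLp (hp : p ≠ ∞) (u : Lp ℂ p (volume : Measure V)) :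
    Continuous (fun y => translateLp p y u) := by
  have hc : Continuous (fun z : V × V => z.2 - z.1) := by fun_prop
  exact Continuous.compMeasurePreservingLp (f := fun _ : V => u)
    (g := fun y => ContinuousMap.curry ⟨fun z : V × V => z.2 - z.1, hc⟩ y) continuous_const
    (ContinuousMap.continuous _) (fun y => measurePreserving_sub_right volume y) hp

theorem translateLp_toLp_ae_eq (y : V) (f : 𝓢(V, ℂ)) :
    translateLp p y (f.toLp p) =ᵐ[volume] fun x => f (x - y) := by
  have h : ∀ u : Lp ℂ p (volume : Measure V), u =ᵐ[volume] f →
      translateLp p y u =ᵐ[volume] fun x => f (x - y) := fun u hu =>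
    (Lp.coeFn_compMeasurePreserving u (measurePreserving_sub_right volume y)).trans
      ((measurePreserving_sub_right volume y).quasiMeasurePreserving.ae_eq_comp hu)
  exact h _ (f.coeFn_toLp p)

theorem integrable_smul_translateLp (hp : p ≠ ∞) {k : V → ℂ} (hk : Integrable k)
    (u : Lp ℂ p (volume : Measure V)) : Integrable (fun y => k y • translateLp p y u) := by
  refine (hk.norm.mul_const ‖u‖).mono'
    (hk.1.smul (continuous_translateLp hp u).aestronglyMeasurable)
    (Filter.Eventually.of_forall fun y => ?_)
  rw [norm_smul, LinearIsometry.norm_map]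

theorem fourierInv_fourierChar_smul_fourier (f : 𝓢(V, ℂ)) (x y : V) :
    𝓕⁻ (fun ξ => Real.fourierChar (-inner ℝ ξ y) • 𝓕 f ξ) x = f (x - y) := by
  have h : 𝓕⁻ (⇑(𝓕 f : 𝓢(V, ℂ))) (x - y) = f (x - y) := by
    rw [← SchwartzMap.fourierInv_coe, FourierTransform.fourierInv_fourier_eq]
  rw [← h, Real.fourierInv_eq, Real.fourierInv_eq]
  congr 1
  ext ξ
  rw [smul_smul, ← AddChar.map_add_eq_mul, inner_sub_right, sub_eq_add_neg]

theorem integral_mul_comp_sub_eq (φ f : 𝓢(V, ℂ)) (y : V) :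
    ∫ x, φ x * f (x - y) = 𝓕 (fun ξ => 𝓕 f ξ * 𝓕⁻ φ ξ) y := by
  have hint : Integrable (fun ξ => Real.fourierChar (-inner ℝ ξ y) • 𝓕 f ξ) :=
    integrable_fourierChar_smul (𝓕 f).integrable y
  simp only [← fourierInv_fourierChar_smul_fourier f]
  rw [integral_mul_fourierInv_eq hint φ.integrable, Real.fourier_eq, ← SchwartzMap.fourierInv_coe]
  simp only [smul_mul_assoc]

/-- Convolution with an integrable kernel on `L^p`, and its action on Schwartz functions as a
Fourier multiplier. -/
theorem exists_convolution_operator (hp : p ≠ ∞) {k : V → ℂ} (hk : Integrable k) :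
    ∃ T : Lp ℂ p (volume : Measure V) →L[ℂ] Lp ℂ p (volume : Measure V),
      (∀ u, ‖T u‖ ≤ (∫ y, ‖k y‖) * ‖u‖) ∧
      ∀ f φ : 𝓢(V, ℂ), (T (f.toLp p) : 𝓢'(V, ℂ)) φ = ∫ ξ, 𝓕 k ξ * (𝓕 f ξ * 𝓕⁻ φ ξ) := by
  -- Convolution as a Bochner integral of translates in `L^p`: translations are isometries, which
  -- gives the norm bound at once, and they are strongly continuous for `p < ∞`.
  let T₀ : Lp ℂ p (volume : Measure V) →ₗ[ℂ] Lp ℂ p (volume : Measure V) :=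
    { toFun := fun u => ∫ y, k y • translateLp p y u
      map_add' := fun u v => by
        rw [← integral_add (integrable_smul_translateLp hp hk u) (integrable_smul_translateLp hp hk v)]
        simp only [map_add, smul_add]
      map_smul' := fun c u => by
        rw [RingHom.id_apply, ← integral_smul]
        simp only [map_smul, smul_comm c] }
  have hT₀ : ∀ u, ‖T₀ u‖ ≤ (∫ y, ‖k y‖) * ‖u‖ := by
    intro u
    refine (norm_integral_le_integral_norm _).trans_eq ?_
    simp only [norm_smul, LinearIsometry.norm_map]
    rw [integral_mul_const]
  have hTe : ∀ (φ : 𝓢(V, ℂ)) (u : Lp ℂ p (volume : Measure V)),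
      (T₀ u : 𝓢'(V, ℂ)) φ = ∫ y, k y * ∫ x, φ x * translateLp p y u x := by
    intro φ u
    -- Pairing with `φ` is a continuous functional, so it passes inside the Bochner integral.
    let ℓ : Lp ℂ p (volume : Measure V) →L[ℂ] ℂ :=
      (PointwiseConvergenceCLM.evalCLM (RingHom.id ℂ) ℂ φ).comp
        (Lp.toTemperedDistributionCLM ℂ (volume : Measure V) p)
    have hℓ : ∀ v : Lp ℂ p (volume : Measure V), ℓ v = ∫ x, φ x * v x :=
      fun v => Lp.toTemperedDistribution_apply v φ
    have h := ℓ.integral_comp_comm (integrable_smul_translateLp hp hk u)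
    simp only [map_smul, smul_eq_mul, hℓ (translateLp p _ u)] at h
    exact h.symm
  refine ⟨T₀.mkContinuous _ hT₀, hT₀, fun f φ => ?_⟩
  have h3 : ∀ u : Lp ℂ p (volume : Measure V), (∀ y, translateLp p y u =ᵐ[volume] fun x => f (x - y)) →
      ∀ y, ∫ x, φ x * translateLp p y u x = 𝓕 (fun ξ => 𝓕 f ξ * 𝓕⁻ φ ξ) y := by
    intro u hu y
    rw [← integral_mul_comp_sub_eq]
    refine integral_congr_ae ?_
    filter_upwards [hu y] with x hx
    rw [hx]
  have hi : Integrable (fun ξ => 𝓕 f ξ * 𝓕⁻ φ ξ) := by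
    refine (𝓕⁻ φ).integrable.bdd_mul (c := ∫ x, ‖f x‖) (𝓕 f).continuous.aestronglyMeasurable
      (Filter.Eventually.of_forall fun ξ => ?_)
    rw [SchwartzMap.fourier_coe]
    exact norm_fourier_le_integral_norm _ _
  rw [integral_fourier_mul_eq_of_integrable hk hi]
  refine (hTe φ _).trans ?_
  simp only [h3 _ fun y => translateLp_toLp_ae_eq (p := p) y f]

end ConvolutionOperator

/-! ### The semigroup symbol as a radial profile -/

section SemigroupProfile

variable {n : ℕ} {γ : ℝ} {g : ℝ → ℝ}

theorem KernelCondition.exists_integral_le (hg_one : ∀ r, 0 ≤ r → 1 ≤ g r)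
    (hg_smooth : ContDiffOn ℝ ((n + 1 : ℕ) : WithTop ℕ∞) g (Ioi 0)) (h : KernelCondition n γ g) :
    ∃ M : ℝ, 0 ≤ M ∧ ∀ t ∈ Ioo (0 : ℝ) 1,
      ContDiffOn ℝ ((n + 1 : ℕ) : ℕ∞)
        (fun r : ℝ => Real.exp (-r ^ γ / g (r * t ^ (-1 / γ)))) (Ioi 0) ∧
      IntegrableOn (fun r => |iteratedDeriv (n + 1)
        (fun r : ℝ => r ^ (n - 1) * Real.exp (-r ^ γ / g (r * t ^ (-1 / γ)))) r|) (Ioi 0) ∧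
      ∫ r in Ioi (0 : ℝ), |iteratedDeriv (n + 1)
        (fun r : ℝ => r ^ (n - 1) * Real.exp (-r ^ γ / g (r * t ^ (-1 / γ)))) r| ≤ M := by
  refine ⟨(⨆ t ∈ Ioo (0 : ℝ) 1, ∫⁻ r in Ioi (0 : ℝ), ‖iteratedDeriv (n + 1)
    (fun r : ℝ => r ^ (n - 1) * Real.exp (-r ^ γ / g (r * t ^ (-1 / γ)))) r‖ₑ).toReal,
    ENNReal.toReal_nonneg, fun t ht => ?_⟩
  have htp : 0 < t ^ (-1 / γ) := Real.rpow_pos_of_pos ht.1 _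
  have hE : ContDiffOn ℝ ((n + 1 : ℕ) : ℕ∞)
      (fun r : ℝ => Real.exp (-r ^ γ / g (r * t ^ (-1 / γ)))) (Ioi 0) := by
    refine Real.contDiff_exp.comp_contDiffOn (ContDiffOn.div ?_ ?_ ?_)
    · exact (contDiffOn_id.rpow_const_of_ne fun x hx => ne_of_gt hx).neg
    · exact hg_smooth.comp (contDiff_id.mul contDiff_const).contDiffOn fun x hx => mul_pos hx htp
    · intro x hx
      have := hg_one (x * t ^ (-1 / γ)) (mul_pos hx htp).le
      positivity
  have hF : ContDiffOn ℝ ((n + 1 : ℕ) : ℕ∞)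
      (fun r : ℝ => r ^ (n - 1) * Real.exp (-r ^ γ / g (r * t ^ (-1 / γ)))) (Ioi 0) :=
    (contDiff_id.pow _).contDiffOn.mul hE
  have hcont := (ContDiffOn.continuousOn_iteratedDeriv_of_isOpen isOpen_Ioi hF le_rfl)
  have hle : ∫⁻ r in Ioi (0 : ℝ), ‖iteratedDeriv (n + 1)
      (fun r : ℝ => r ^ (n - 1) * Real.exp (-r ^ γ / g (r * t ^ (-1 / γ)))) r‖ₑ ≤
      ⨆ t ∈ Ioo (0 : ℝ) 1, ∫⁻ r in Ioi (0 : ℝ), ‖iteratedDeriv (n + 1)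
        (fun r : ℝ => r ^ (n - 1) * Real.exp (-r ^ γ / g (r * t ^ (-1 / γ)))) r‖ₑ :=
    le_iSup₂ (f := fun (t : ℝ) (_ : t ∈ Ioo (0 : ℝ) 1) => ∫⁻ r in Ioi (0 : ℝ),
      ‖iteratedDeriv (n + 1)
        (fun r : ℝ => r ^ (n - 1) * Real.exp (-r ^ γ / g (r * t ^ (-1 / γ)))) r‖ₑ) t ht
  have hint : IntegrableOn (iteratedDeriv (n + 1)
      (fun r : ℝ => r ^ (n - 1) * Real.exp (-r ^ γ / g (r * t ^ (-1 / γ))))) (Ioi 0) :=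
    ⟨hcont.aestronglyMeasurable measurableSet_Ioi, hle.trans_lt h⟩
  refine ⟨hE, hint.norm, ?_⟩
  have := integral_norm_eq_lintegral_enorm hint.1
  simp only [Real.norm_eq_abs] at this
  rw [this]
  exact ENNReal.toReal_mono h.ne hle

theorem exists_radialProfile {B : ℝ} (hγ : 1 < γ) (hg_one : ∀ r, 0 ≤ r → 1 ≤ g r)
    (hB : ∀ r, 0 ≤ r → g r ≤ B)
    (hg_smooth : ContDiffOn ℝ ((n + 1 : ℕ) : WithTop ℕ∞) g (Ioi 0)) (h : KernelCondition n γ g) :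
    ∃ D : ℕ → ℝ, ∃ M : ℝ, (∀ k, 0 ≤ D k) ∧ 0 ≤ M ∧ ∀ t ∈ Ioo (0 : ℝ) 1,
      RadialProfile n D M (fun r : ℝ => Real.exp (-r ^ γ / g (r * t ^ (-1 / γ)))) := by
  obtain ⟨M, hM, hM'⟩ := h.exists_integral_le hg_one hg_smooth
  have hB1 : 1 ≤ B := (hg_one 0 le_rfl).trans (hB 0 le_rfl)
  have hB0 : 0 < B := by linarith
  -- From `r - 1 ≤ r ^ γ` and `g ≤ B` the profile is at most `e^{1/B} e^{-r/B}`, and `(r/B)^k / k! ≤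
  -- e^{r/B}`.
  refine ⟨fun k => Real.exp (1 / B) * (k.factorial * B ^ k), M, fun k => by positivity, hM,
    fun t ht => ?_⟩
  obtain ⟨h1, h2, h3⟩ := hM' t ht
  have htp : 0 < t ^ (-1 / γ) := Real.rpow_pos_of_pos ht.1 _
  have hg1 : ∀ r, 0 < r → 1 ≤ g (r * t ^ (-1 / γ)) := fun r hr => hg_one _ (mul_pos hr htp).le
  have hle1 : ∀ r, 0 < r → Real.exp (-r ^ γ / g (r * t ^ (-1 / γ))) ≤ 1 := by
    intro r hr
    have := hg1 r hr
    rw [Real.exp_le_one_iff, neg_div, Left.neg_nonpos_iff]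
    positivity
  refine ⟨h1, ?_, fun r _ => (Real.exp_pos _).le, hle1, fun r hr => ?_, fun k r hr => ?_, h2, h3⟩
  · simp [Real.zero_rpow (by linarith : γ ≠ 0)]
  · rcases le_total 1 r with h | h
    · linarith [Real.exp_pos (-r ^ γ / g (r * t ^ (-1 / γ)))]
    · have e1 := Real.add_one_le_exp (-r ^ γ / g (r * t ^ (-1 / γ)))
      have e2 : r ^ γ / g (r * t ^ (-1 / γ)) ≤ r ^ γ :=
        div_le_self (Real.rpow_nonneg hr.le _) (hg1 r hr)
      have e3 : r ^ γ ≤ r := by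
        simpa using Real.rpow_le_rpow_of_exponent_ge hr h hγ.le
      rw [neg_div] at e1 ⊢
      linarith
  · have e1 : r - 1 ≤ r ^ γ := by
      rcases le_total 1 r with h | h
      · have : r ≤ r ^ γ := by simpa using Real.rpow_le_rpow_of_exponent_le h hγ.le
        linarith
      · linarith [Real.rpow_nonneg hr.le γ]
    have e2 : -r ^ γ / g (r * t ^ (-1 / γ)) ≤ 1 / B + -(r / B) := by
      have a1 : r ^ γ / B ≤ r ^ γ / g (r * t ^ (-1 / γ)) :=
        div_le_div_of_nonneg_left (Real.rpow_nonneg hr.le _) (by linarith [hg1 r hr])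
          (hB _ (mul_pos hr htp).le)
      have a2 : (r - 1) / B ≤ r ^ γ / B := by gcongr
      rw [sub_div] at a2
      rw [neg_div]
      linarith
    have e3 := Real.pow_div_factorial_le_exp (r / B) (by positivity) k
    rw [div_pow, div_div, div_le_iff₀ (by positivity)] at e3
    calc r ^ k * Real.exp (-r ^ γ / g (r * t ^ (-1 / γ)))
        ≤ r ^ k * (Real.exp (1 / B) * Real.exp (-(r / B))) := by
          rw [← Real.exp_add]; gcongr
      _ ≤ (Real.exp (r / B) * (B ^ k * k.factorial)) * (Real.exp (1 / B) * Real.exp (-(r / B))) := by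
          gcongr
      _ = Real.exp (1 / B) * (k.factorial * B ^ k) := by
          rw [Real.exp_neg]
          field_simp

end SemigroupProfile

/-! ### Kernel bounds for the semigroup -/

section SemigroupSymbol

variable {n : ℕ} {γ : ℝ} {g : ℝ → ℝ}

theorem semigroupSymbol_two_pi_smul (hγ : 1 < γ) {t : ℝ} (ht : 0 < t)
    (ξ : EuclideanSpace ℝ (Fin n)) :
    semigroupSymbol γ g t ((2 * Real.pi) • ξ) =
      ((Real.exp (-(2 * Real.pi * t ^ (1 / γ) * ‖ξ‖) ^ γ /
        g (2 * Real.pi * t ^ (1 / γ) * ‖ξ‖ * t ^ (-1 / γ))) : ℝ) : ℂ) := by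
  have hγ0 : γ ≠ 0 := by linarith
  have hπ := Real.pi_pos
  have hn : ‖(2 * Real.pi) • ξ‖ = 2 * Real.pi * ‖ξ‖ := by
    rw [norm_smul, Real.norm_of_nonneg (by positivity)]
  have e1 : 2 * Real.pi * t ^ (1 / γ) * ‖ξ‖ * t ^ (-1 / γ) = 2 * Real.pi * ‖ξ‖ := by
    have : t ^ (1 / γ) * t ^ (-1 / γ) = 1 := by
      rw [← Real.rpow_add ht, neg_div, add_neg_cancel, Real.rpow_zero]
    linear_combination (2 * Real.pi * ‖ξ‖) * this
  have e2 : (2 * Real.pi * t ^ (1 / γ) * ‖ξ‖) ^ γ = t * (2 * Real.pi * ‖ξ‖) ^ γ := by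
    rw [show 2 * Real.pi * t ^ (1 / γ) * ‖ξ‖ = t ^ (1 / γ) * (2 * Real.pi * ‖ξ‖) by ring,
      Real.mul_rpow (by positivity) (by positivity), ← Real.rpow_mul ht.le, one_div,
      inv_mul_cancel₀ hγ0, Real.rpow_one]
  rw [semigroupSymbol, hn, e1, e2, neg_mul]

theorem semigroupSymbol_pow (N : ℕ) (t : ℝ) (ξ : EuclideanSpace ℝ (Fin n)) :
    semigroupSymbol γ g t ξ ^ N = semigroupSymbol γ g (N * t) ξ := by
  rw [semigroupSymbol, semigroupSymbol, ← Complex.ofReal_pow, ← Real.exp_nat_mul,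
    show N * (-t * ‖ξ‖ ^ γ / g ‖ξ‖) = -(N * t) * ‖ξ‖ ^ γ / g ‖ξ‖ by ring]

/-- The kernel of `(1 + |D|²)^{σ/2} e^{tL}` is integrable, with norm `O(t^{-σ/γ})`. -/
theorem exists_hasKernelBound_semigroup {B σ t₀ : ℝ} (hn : 1 ≤ n) (hγ : 1 < γ)
    (hg_one : ∀ r, 0 ≤ r → 1 ≤ g r) (hB : ∀ r, 0 ≤ r → g r ≤ B)
    (hg_smooth : ContDiffOn ℝ ((n + 1 : ℕ) : WithTop ℕ∞) g (Ioi 0)) (h : KernelCondition n γ g)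
    (hσ : 0 ≤ σ) (ht₀ : 0 < t₀) :
    ∃ C : ℝ, ∀ t ∈ Ioc (0 : ℝ) t₀, HasKernelBound (fun ξ : EuclideanSpace ℝ (Fin n) =>
      (((1 + ‖ξ‖ ^ 2) ^ (σ / 2) : ℝ) : ℂ) * semigroupSymbol γ g t ((2 * Real.pi) • ξ))
      (C * t ^ (-σ / γ)) := by
  have : Nonempty (Fin n) := ⟨⟨0, hn⟩⟩
  obtain ⟨D, M, hD, hM, hE⟩ := exists_radialProfile hγ hg_one hB hg_smooth h
  have hfin : Module.finrank ℝ (EuclideanSpace ℝ (Fin n)) = n := finrank_euclideanSpace_fin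
  have hπ := Real.pi_pos
  obtain ⟨C₁, hC₁⟩ := exists_hasKernelBound_profile (EuclideanSpace ℝ (Fin n)) D M hfin hM hD
  obtain ⟨C₂, hC₂0, hC₂⟩ := exists_hasKernelBound_smoothing (EuclideanSpace ℝ (Fin n)) D M hfin hM hD
    hσ (y₀ := 2 * Real.pi) (by positivity)
  -- All `t ≤ t₀` satisfy `t / N < 1`. One of the `N` factors carries the Bessel weight and the
  -- other `N - 1` contribute `C₁` each.
  obtain ⟨N, hN⟩ := exists_nat_gt t₀
  have hN0 : (0 : ℝ) < N := ht₀.trans hN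
  refine ⟨C₁ ^ (N - 1) * (C₂ * (2 * Real.pi * (1 / N) ^ (1 / γ)) ^ (-σ)), fun t ht => ?_⟩
  set t' := t / N with ht'
  have ht'0 : 0 < t' := div_pos ht.1 hN0
  have ht'1 : t' < 1 := (div_lt_one hN0).2 (ht.2.trans_lt hN)
  set y := 2 * Real.pi * t' ^ (1 / γ) with hy
  have hty : t' ^ (1 / γ) ≤ 1 := Real.rpow_le_one ht'0.le ht'1.le (by positivity)
  have hy0 : 0 < y := by positivity
  have hP := hE t' ⟨ht'0, ht'1⟩
  have hsym : ∀ ξ : EuclideanSpace ℝ (Fin n), _ := fun ξ =>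
    semigroupSymbol_two_pi_smul (g := g) hγ ht'0 ξ
  have hb : HasKernelBound (fun ξ : EuclideanSpace ℝ (Fin n) =>
      semigroupSymbol γ g t' ((2 * Real.pi) • ξ)) C₁ := by
    refine ((hC₁ _ hP).comp_smul hy0).congr fun ξ => ?_
    rw [hsym, norm_smul, Real.norm_of_nonneg hy0.le]
  have hs := hC₂ _ y hP ⟨hy0, by rw [hy]; nlinarith⟩
  refine ((hs.one_pow_mul hb (N - 1)).congr fun ξ => ?_).mono ?_
  · have : N - 1 + 1 = N := by
      have : 0 < N := by exact_mod_cast hN0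
      omega
    have ht2 : t = N * t' := by rw [ht']; field_simp
    have e : semigroupSymbol γ g t ((2 * Real.pi) • ξ) =
        semigroupSymbol γ g t' ((2 * Real.pi) • ξ) ^ (N - 1) *
          semigroupSymbol γ g t' ((2 * Real.pi) • ξ) := by
      rw [← pow_succ, this, semigroupSymbol_pow, ← ht2]
    rw [e, Complex.ofReal_mul]
    conv_rhs => rw [mul_left_comm]
    simp only [hsym, hy]
  · have e : y = (2 * Real.pi * (1 / N) ^ (1 / γ)) * t ^ (1 / γ) := by
      rw [hy, ht', div_eq_mul_one_div, Real.mul_rpow ht.1.le (by positivity)]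
      ring
    rw [e, Real.mul_rpow (by positivity) (Real.rpow_nonneg ht.1.le _), ← Real.rpow_mul ht.1.le]
    apply le_of_eq
    rw [show 1 / γ * -σ = -σ / γ by ring]
    ring

end SemigroupSymbol

/-! ### Transfer to Bessel potential spaces -/

section SobolevOperators

variable {n : ℕ} {s₁ s₂ : ℝ} {p : ℝ≥0∞} [Fact (1 ≤ p)]

namespace SobolevSpace

/-- The element of `H^{s,p}` with a given Bessel potential of order `s`. -/
noncomputable def ofBesselLp (s : ℝ) (v : Lp ℂ p (volume : Measure (EuclideanSpace ℝ (Fin n)))) :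
    SobolevSpace n s p :=
  ⟨besselPotential _ ℂ (-s) (v : 𝓢'(EuclideanSpace ℝ (Fin n), ℂ)), v, by simp⟩

theorem besselLp_ofBesselLp (s : ℝ) (v : Lp ℂ p (volume : Measure (EuclideanSpace ℝ (Fin n)))) :
    besselLp (ofBesselLp s v) = v := by
  apply toTemperedDistribution_injective
  beta_reduce
  rw [← besselLp_spec]
  change besselPotential _ ℂ s (besselPotential _ ℂ (-s) _) = _
  simp

theorem besselLp_injective :
    Function.Injective (besselLp : SobolevSpace n s₁ p → _) := besselLpLinear_injective

/-- Conjugation of an operator on `L^p` by Bessel potentials. -/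
noncomputable def conjBessel (s₁ s₂ : ℝ)
    (K : Lp ℂ p (volume : Measure (EuclideanSpace ℝ (Fin n))) →L[ℂ]
      Lp ℂ p (volume : Measure (EuclideanSpace ℝ (Fin n)))) :
    SobolevSpace n s₁ p →ₗ[ℂ] SobolevSpace n s₂ p where
  toFun u := ofBesselLp s₂ (K (besselLp u))
  map_add' u v := by
    apply besselLp_injective
    have h : ∀ a b : SobolevSpace n s₂ p, besselLp (a + b) = besselLp a + besselLp b :=
      besselLpLinear.map_add
    have h' : besselLp (u + v) = besselLp u + besselLp v := besselLpLinear.map_add u v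
    rw [h, h', besselLp_ofBesselLp, besselLp_ofBesselLp, besselLp_ofBesselLp, map_add]
  map_smul' c u := by
    apply besselLp_injective
    have h : ∀ a : SobolevSpace n s₂ p, besselLp (c • a) = c • besselLp a :=
      besselLpLinear.map_smul c
    have h' : besselLp (c • u) = c • besselLp u := besselLpLinear.map_smul c u
    rw [RingHom.id_apply, h, h', besselLp_ofBesselLp, besselLp_ofBesselLp, map_smul]

theorem norm_conjBessel_le
    {K : Lp ℂ p (volume : Measure (EuclideanSpace ℝ (Fin n))) →L[ℂ]
      Lp ℂ p (volume : Measure (EuclideanSpace ℝ (Fin n)))} {C : ℝ}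
    (hK : ∀ v, ‖K v‖ ≤ C * ‖v‖) (u : SobolevSpace n s₁ p) :
    ‖conjBessel s₁ s₂ K u‖ ≤ C * ‖u‖ := by
  rw [norm_eq, norm_eq]
  change ‖besselLp (ofBesselLp s₂ (K (besselLp u)))‖ ≤ _
  rw [besselLp_ofBesselLp]
  exact hK _

theorem toDistribution_conjBessel
    (K : Lp ℂ p (volume : Measure (EuclideanSpace ℝ (Fin n))) →L[ℂ]
      Lp ℂ p (volume : Measure (EuclideanSpace ℝ (Fin n)))) (u : SobolevSpace n s₁ p)
    (φ : 𝓢(EuclideanSpace ℝ (Fin n), ℂ)) :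
    (conjBessel s₁ s₂ K u).toDistribution φ =
      (K (besselLp u) : 𝓢'(EuclideanSpace ℝ (Fin n), ℂ)) (𝓕 (SchwartzMap.smulLeftCLM ℂ
        (fun x : EuclideanSpace ℝ (Fin n) => (((1 + ‖x‖ ^ 2) ^ (-s₂ / 2) : ℝ) : ℂ)) (𝓕⁻ φ))) := by
  rfl

theorem besselLp_ofSchwartz (f : 𝓢(EuclideanSpace ℝ (Fin n), ℂ)) :
    besselLp (ofSchwartz f : SobolevSpace n s₁ p) =
      (SchwartzMap.fourierMultiplierCLM ℂ
        (fun x : EuclideanSpace ℝ (Fin n) => (((1 + ‖x‖ ^ 2) ^ (s₁ / 2) : ℝ) : ℂ)) f).toLp p := by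
  apply toTemperedDistribution_injective
  beta_reduce
  rw [← besselLp_spec, Lp.toTemperedDistribution_toLp_eq]
  exact fourierMultiplierCLM_toTemperedDistributionCLM_eq (by fun_prop) f

end SobolevSpace

theorem hasTemperateGrowth_one_add_norm_sq_rpow_complex (s : ℝ) :
    (fun x : EuclideanSpace ℝ (Fin n) =>
      (((1 + ‖x‖ ^ 2) ^ (s / 2) : ℝ) : ℂ)).HasTemperateGrowth := by
  fun_prop

theorem fourier_fourierMultiplierCLM_apply {w : EuclideanSpace ℝ (Fin n) → ℂ}
    (hw : w.HasTemperateGrowth) (f : 𝓢(EuclideanSpace ℝ (Fin n), ℂ))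
    (ξ : EuclideanSpace ℝ (Fin n)) :
    𝓕 (SchwartzMap.fourierMultiplierCLM ℂ w f) ξ = w ξ * 𝓕 f ξ := by
  rw [SchwartzMap.fourierMultiplierCLM_apply, FourierTransform.fourier_fourierInv_eq,
    SchwartzMap.smulLeftCLM_apply_apply hw, smul_eq_mul]

/-- On Schwartz functions the weights of orders `s₁`, `s₂ - s₁` and `-s₂` multiply to `1`, so the
conjugated convolution has exactly the symbol `m`. -/
theorem exists_sobolev_fourierMultiplier (hp : p ≠ ∞) {m : EuclideanSpace ℝ (Fin n) → ℂ} {C : ℝ}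
    (hm : HasKernelBound (fun ξ => (((1 + ‖ξ‖ ^ 2) ^ ((s₂ - s₁) / 2) : ℝ) : ℂ) *
      m ((2 * Real.pi) • ξ)) C)
    (hint : ∀ f : 𝓢(EuclideanSpace ℝ (Fin n), ℂ), Integrable (symbolMul m f)) :
    ∃ T : SobolevSpace n s₁ p →L[ℂ] SobolevSpace n s₂ p,
      IsFourierMultiplier m T ∧ ∀ u, ‖T u‖ ≤ C * ‖u‖ := by
  obtain ⟨k, hk, hkC, hkm⟩ := hm
  obtain ⟨K, hK, hKf⟩ := exists_convolution_operator (p := p) hp hk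
  have hK' : ∀ v, ‖K v‖ ≤ C * ‖v‖ := fun v =>
    (hK v).trans (mul_le_mul_of_nonneg_right hkC (norm_nonneg v))
  refine ⟨(SobolevSpace.conjBessel s₁ s₂ K).mkContinuous C (SobolevSpace.norm_conjBessel_le hK'),
    fun f => ⟨hint f, fun φ => ?_⟩, SobolevSpace.norm_conjBessel_le hK'⟩
  rw [LinearMap.mkContinuous_apply, SobolevSpace.toDistribution_conjBessel,
    SobolevSpace.besselLp_ofSchwartz, hKf, multiplierApply,
    integral_mul_fourierInv_eq (hint f) φ.integrable]
  congr 1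
  ext ξ
  rw [fourier_fourierMultiplierCLM_apply (hasTemperateGrowth_one_add_norm_sq_rpow_complex s₁),
    FourierTransform.fourierInv_fourier_eq,
    SchwartzMap.smulLeftCLM_apply_apply (hasTemperateGrowth_one_add_norm_sq_rpow_complex (-s₂)),
    hkm, symbolMul, ← SchwartzMap.fourierInv_coe, smul_eq_mul]
  have hpos : 0 < 1 + ‖ξ‖ ^ 2 := by positivity
  have h1 : (1 + ‖ξ‖ ^ 2) ^ ((s₂ - s₁) / 2) * (1 + ‖ξ‖ ^ 2) ^ (s₁ / 2) *
      (1 + ‖ξ‖ ^ 2) ^ (-s₂ / 2) = 1 := by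
    rw [← Real.rpow_add hpos, ← Real.rpow_add hpos,
      show (s₂ - s₁) / 2 + s₁ / 2 + -s₂ / 2 = 0 by ring, Real.rpow_zero]
  have h2 := congrArg (fun x : ℝ => (x : ℂ)) h1
  push_cast at h2 ⊢
  linear_combination (m ((2 * Real.pi) • ξ) * 𝓕 f ξ * 𝓕⁻ φ ξ) * h2

theorem integrable_symbolMul_semigroupSymbol {γ t : ℝ} {g : ℝ → ℝ} (hg_mono : MonotoneOn g (Ici 0))
    (hg_nonneg : ∀ r, 0 ≤ r → 0 ≤ g r) (ht : 0 ≤ t) (f : 𝓢(EuclideanSpace ℝ (Fin n), ℂ)) :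
    Integrable (symbolMul (semigroupSymbol γ g t) f) := by
  have hmeas : Measurable (fun ξ : EuclideanSpace ℝ (Fin n) =>
      semigroupSymbol γ g t ((2 * Real.pi) • ξ)) := by
    have h1 : Measurable (semigroupSymbol (n := n) γ g t) :=
      Complex.measurable_ofReal.comp (Real.measurable_exp.comp
        ((((measurable_norm.pow_const γ).const_mul (-t))).div
          (measurable_comp_norm_of_monotoneOn hg_mono)))
    exact h1.comp (measurable_const_smul _)
  refine (𝓕 f).integrable.bdd_mul (c := 1) hmeas.aestronglyMeasurable
    (Filter.Eventually.of_forall fun ξ => ?_)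
  rw [semigroupSymbol, Complex.norm_real, Real.norm_of_nonneg (Real.exp_pos _).le,
    Real.exp_le_one_iff, neg_mul, neg_div, Left.neg_nonpos_iff]
  have := hg_nonneg _ (norm_nonneg ((2 * Real.pi) • ξ))
  positivity

end SobolevOperators

/-! ### The smoothing estimate -/

theorem proposition5p6 (n : ℕ) (hn : 1 ≤ n) (p : ℝ≥0∞) [Fact (1 ≤ p)] (hp_one : 1 < p)
    (hp_top : p < ∞) (s₁ s₂ : ℝ) (hs : s₁ ≤ s₂) (γ : ℝ) (hγ : 1 < γ) (g : ℝ → ℝ)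
    (hg_mono : MonotoneOn g (Ici 0)) (hg_one : ∀ r, 0 ≤ r → 1 ≤ g r)
    (hg_smooth : ContDiffOn ℝ ((n + 1 : ℕ) : WithTop ℕ∞) g (Ioi 0))
    (hg_kernel : KernelCondition n γ g)
    (hG : MultiplierBoundedOnLp p (fun ξ : EuclideanSpace ℝ (Fin n) => (g ‖ξ‖ : ℂ))) :
    ∀ t₀ : ℝ, 0 < t₀ → ∃ C : ℝ, ∀ t ∈ Ioc (0 : ℝ) t₀,
      ∃ T : SobolevSpace n s₁ p →L[ℂ] SobolevSpace n s₂ p,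
        IsFourierMultiplier (semigroupSymbol γ g t) T ∧
        ∀ f : SobolevSpace n s₁ p, ‖T f‖ ≤ C * t ^ (-(s₂ - s₁) / γ) * ‖f‖ := by
  intro t₀ ht₀
  have hg_nonneg : ∀ r, 0 ≤ r → 0 ≤ g r := fun r hr => zero_le_one.trans (hg_one r hr)
  obtain ⟨B, hB⟩ := hG.exists_le hn hg_mono hg_nonneg
  obtain ⟨C, hC⟩ := exists_hasKernelBound_semigroup hn hγ hg_one hB hg_smooth hg_kernel
    (sub_nonneg.2 hs) ht₀
  exact ⟨C, fun t ht => exists_sobolev_fourierMultiplier hp_top.ne (hC t ht)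
    (integrable_symbolMul_semigroupSymbol hg_mono hg_nonneg ht.1.le)⟩
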